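/- **Conventions.** A variety is an equational class of algebras. For ternary terms $t_0,\dots,t_n$ of a variety $\mathcal V$ consider the identities $$(\mathrm B)\quad t_0(x,y,z)=x,\qquad t_n(x,y,z)=z,\qquad t_h(x,y,x)=x\ \ (0\le h\le n),$$ and, for $0\le h<n$, $$(\mathrm L_h)\ t_h(x,x,z)=t_{h+1}(x,x,z),\qquad (\mathrm R_h)\ t_h(x,z,z)=t_{h+1}(x,z,z),$$ $$(\mathrm F_h)\ t_h(x,z,z)=t_{h+1}(x,x,z),\qquad (\mathrm P_h)\ t_h(x,x,z)=t_{h+1}(x,z,z).$$ The variety $\mathcal V$ is * *$n$-distributive* if it has terms satisfying (B), $(\mathrm L_h)$ for all even $h<n$ and $(\mathrm R_h)$ for all odd $h<n$; * *$n$-alvin* if it has terms satisfying (B), $(\mathrm R_h)$ for all even $h<n$ and $(\mathrm L_h)$ for all odd $h<n$; * *$n$-Gumm* if it satisfies the definition of $n$-alvin with the identity $t_1(x,y,x)=x$ not required; * *$n$-directed-distributive* if it has terms satisfying (B) and $(\mathrm F_h)$ for all $h<n$; * *$n$-mixed Jónsson* if it has terms satisfying (B) and, for each $h<n$, at least one of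 $(\mathrm L_h),(\mathrm R_h),(\mathrm F_h),(\mathrm P_h)$; * *two-headed $n$-directed Gumm* ($n\ge 4$) if it has ternary terms $p,t_2,\dots,t_{n-2},q$ with $t_h(x,y,x)=x$ for $2\le h\le n-2$, $p(x,z,z)=x$, $p(x,x,z)=t_2(x,x,z)$, $t_h(x,z,z)=t_{h+1}(x,x,z)$ for $2\le h<n-2$, $t_{n-2}(x,z,z)=q(x,z,z)$ and $q(x,x,z)=z$; * *$n$-directed with alvin heads* ($n\ge4$) if, moreover, $p(x,y,x)=x$ and $q(x,y,x)=x$; * *$m$-modular* if it has quaternary terms $u_0,\dots,u_m$ with $u_0(x,y,z,w)=x$, $u_m(x,y,z,w)=w$, $u_k(x,y,y,x)=x$ for $0\le k\le m$, $u_k(x,x,w,w)=u_{k+1}(x,x,w,w)$ for even $k<m$ and $u_k(x,y,y,w)=u_{k+1}(x,y,y,w)$ for odd $k<m$; * *$m$-reversed-modular* if the same holds with "even" and "odd" exchanged. Further, with $\ell=\lfloor n/2\rfloor$, juxtaposition for intersection, $\circ$ for relational composition, $R^k$ for the $k$-fold composition of $R$ with itself ($R^0$ is equality), and $\alpha,\beta,\gamma$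 ranging over the congruences of the algebras in $\mathcal V$: the *switch level* of $\mathcal V$ is the smallest $n\ge 0$ such that $\alpha(\beta\circ\gamma)\subseteq(\alpha(\gamma\circ\beta))^{\ell}$ holds in $\mathcal V$ and $n$ is even, or $\alpha(\beta\circ\gamma)\subseteq(\alpha(\gamma\circ\beta))^{\ell}\circ\alpha\gamma$ holds in $\mathcal V$ and $n$ is odd; the *J-switch level* is the smallest $n\ge1$ such that $\alpha(\beta\circ\gamma)\subseteq\alpha\beta\circ(\alpha(\gamma\circ\beta))^{\ell-1}\circ\alpha\gamma$ holds in $\mathcal V$ and $n$ is even, or $\alpha(\beta\circ\gamma)\subseteq\alpha\beta\circ(\alpha(\gamma\circ\beta))^{\ell}$ holds in $\mathcal V$ and $n$ is odd. The other levels (distributive, alvin, and so on) are the smallest $n$ for which the corresponding condition above holds. **The varieties.** Let $n\ge2$ and $\ell=\lfloor n/2\rfloor$. For a lattice $\mathbf L$ and $0<i\le n/2$, let $\mathbf L^{i,n}$ be the algebra on $L$ with ternary operations $t_1,\dots,t_{n-1}$ where, if $i<n/2$, $$t_h(x,y,z)=\begin{cases}x&h<i\\ x(y+z)&h=i\\ xz&i<h<n-i\\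 z(y+x)&h=n-i\\ z&h>n-i\end{cases}$$ and, if $i=n/2$, $t_h(x,y,z)$ is $x$ for $h<i$, $xy+xz+yz$ for $h=i$, and $z$ for $h>i$ (juxtaposition and $+$ are meet and join). For a Boolean algebra $\mathbf A$, the algebra $\mathbf A^{i,n}$ is defined by the same formulas with $y$ replaced everywhere by its complement $y'$. Let $\mathbf C$ be the two-element lattice and $\mathbf 2$ the two-element Boolean algebra. Then * $\mathcal V_n^a$ is the variety generated by $\mathbf C^{i,n}$ ($i$ odd) and $\mathbf 2^{i,n}$ ($i$ even), $1\le i\le\ell$; * $\mathcal V_n^b$ is the variety generated by $\mathbf 2^{i,n}$ ($i$ odd) and $\mathbf C^{i,n}$ ($i$ even), $1\le i\le\ell$; * $\mathcal V_n^c$ is the variety generated by $\mathbf C^{i,n}$, $1\le i\le\ell$; * $\mathcal V_n^d$ ($n\ge4$) is the variety generated by $\mathbf 2^{1,n}$ and $\mathbf C^{i,n}$, $2\le i\le\ell$; * $\mathcal V_n^e$ is the non-indexed product of $\mathcal V_n^a$ and $\mathcal V_n^b$; * $\mathcal V_n^f$ ($n\ge3$) is the non-indexed product of $\mathcal V_n^c$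 and $\mathcal V_{n+1}^d$. Here the non-indexed product of varieties $\mathcal V$ and $\mathcal W$ has as $k$-ary operation symbols all pairs $(s,t)$ of a $k$-ary term of $\mathcal V$ and a $k$-ary term of $\mathcal W$, and consists of the isomorphic copies of the algebras on $A\times B$, with $\mathbf A\in\mathcal V$, $\mathbf B\in\mathcal W$, on which $(s,t)$ acts as $s^{\mathbf A}$ on the first and as $t^{\mathbf B}$ on the second coordinate. **Theorem.** All the levels listed in the following table exist and have the values shown, for every $n\ge 2$ satisfying the condition at the head of the column; for the entries marked $*$ it is assumed that $n\ge4$. $$\begin{array}{|l|c|c|c|c|c|c|} \hline & \mathcal V_n^a & \mathcal V_n^b & \mathcal V_n^c & \mathcal V_n^d & \mathcal V_n^e & \mathcal V_n^f\\ \text{level} & n\text{ even} & n\text{ even} & n\ge2 & n\ge4 & n\text{ even} & n\ge3\\ \hline \text{distributive; J-switch} & n & n+1^* & 2n-2 & 2n-3 & n+1^* & 2n-1\\ \text{alvin; Gumm; switch} & n+1 & n & 2n-1 & 2n-4 & n+1 & 2n-1\\ \text{modular} & 2n-1 & 2n-2 & 2n-1 & 2n-2 & 2n-1 & 2n\\ \text{reversed-modular}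 & 2n & 2n-3^* & 2n & 2n-3 & 2n & 2n\\ \text{directed-distributive; mixed J\'onsson} & n & n & n & n & n & n+1\\ \text{two-headed directed Gumm; directed with alvin heads} & n+2 & n^* & n+2 & n & n+2 & n+2\\ \hline \end{array}$$ -/

import Mathlib

open CategoryTheory
open scoped SetRel

namespace CongLevels

/-! ### Algebras, identities, varieties

An algebraic signature is a first-order language, of which only the function symbols matter
here, and an algebra is a structure for it. A class of algebras is a set of bundled structures. -/

/-- A class of algebras of signature `L`. -/
abbrev AlgClass (L : FirstOrder.Language.{0, 0}) := Set (Bundled.{0} L.Structure)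

/-- The algebra `A` satisfies the identity `s = t` (in countably many variables). -/
def Satisfies {L : FirstOrder.Language.{0, 0}} (A : Bundled.{0} L.Structure) (s t : L.Term ℕ) : Prop :=
  ∀ v : ℕ → A, s.realize v = t.realize v

/-- The variety generated by `K`: the smallest equational class containing `K`, that is, the
class of all algebras satisfying every identity which is satisfied by all members of `K`. -/
def variety {L : FirstOrder.Language.{0, 0}} (K : AlgClass L) : AlgClass L :=
  {A | ∀ s t : L.Term ℕ, (∀ B ∈ K, Satisfies B s t) → Satisfies A s t}

/-- The value `t(x, y, z)` of a ternary term. -/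
def ev3 {L : FirstOrder.Language.{0, 0}} {A : Bundled.{0} L.Structure} (t : L.Term (Fin 3)) (x y z : A) : A :=
  t.realize ![x, y, z]

/-- The value `u(x, y, z, w)` of a quaternary term. -/
def ev4 {L : FirstOrder.Language.{0, 0}} {A : Bundled.{0} L.Structure} (u : L.Term (Fin 4))
    (x y z w : A) : A :=
  u.realize ![x, y, z, w]

/-! ### Non-indexed products -/

/-- The signature of a non-indexed product: its `k`-ary operation symbols are the pairs of
`k`-ary terms of the two given signatures. -/
def prodSig (L M : FirstOrder.Language.{0, 0}) : FirstOrder.Language.{0, 0} where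
  Functions k := L.Term (Fin k) × M.Term (Fin k)
  Relations _ := Empty

/-- The non-indexed product `A ⊗ B` of two algebras: the base set is `A × B`, and a pair
of terms acts coordinatewise. -/
def algProd {L M : FirstOrder.Language.{0, 0}} (A : Bundled.{0} L.Structure) (B : Bundled.{0} M.Structure) :
    Bundled.{0} (prodSig L M).Structure where
  α := A × B
  str :=
    { funMap := fun f v => (f.1.realize fun i => (v i).1, f.2.realize fun i => (v i).2)
      RelMap := fun r _ => Empty.elim r }

/-- The non-indexed product of two varieties: all isomorphic copies of the algebras `A ⊗ B`
with `A` in the first variety and `B` in the second one. -/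
def varProd {L M : FirstOrder.Language.{0, 0}} (V : AlgClass L) (W : AlgClass M) : AlgClass (prodSig L M) :=
  {C | ∃ A ∈ V, ∃ B ∈ W, Nonempty (FirstOrder.Language.Equiv (prodSig L M) C (algProd A B))}

/-! ### The algebras `L^{i,n}` and `A^{i,n}` -/

/-- The operation symbols `t_1, …, t_{n-1}`, all of them ternary. -/
inductive TernarySymb (n : ℕ) : ℕ → Type
  | t (h : ℕ) (h_pos : 0 < h) (h_lt : h < n) : TernarySymb n 3

/-- The signature with ternary operation symbols `t_1, …, t_{n-1}` and nothing else. -/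
def sig (n : ℕ) : FirstOrder.Language.{0, 0} where
  Functions := TernarySymb n
  Relations _ := Empty

/-- The operation `t_h` of `L^{i,n}`, for `L` a lattice, `0 < i ≤ n/2` and `0 < h < n`. -/
def latOp {L : Type} [Lattice L] (n i h : ℕ) (x y z : L) : L :=
  if h < i then x
  else if h = i then
    (if 2 * i = n then (x ⊓ y) ⊔ (x ⊓ z) ⊔ (y ⊓ z) else x ⊓ (y ⊔ z))
  else if h < n - i then x ⊓ z
  else if h = n - i then z ⊓ (y ⊔ x)
  else z

/-- The operation `t_h` of `A^{i,n}`, for `A` a Boolean algebra, `0 < i ≤ n/2` and `0 < h < n`. -/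
def boolOp {A : Type} [BooleanAlgebra A] (n i h : ℕ) (x y z : A) : A :=
  if h < i then x
  else if h = i then
    (if 2 * i = n then (x ⊓ yᶜ) ⊔ (x ⊓ z) ⊔ (yᶜ ⊓ z) else x ⊓ (yᶜ ⊔ z))
  else if h < n - i then x ⊓ z
  else if h = n - i then z ⊓ (yᶜ ⊔ x)
  else z

/-- The algebra of signature `sig n` in which `t_h` is interpreted as `op h`. -/
def ternaryAlg (n : ℕ) (A : Type) (op : ℕ → A → A → A → A) : Bundled.{0} (sig n).Structure where
  α := A
  str :=
    { funMap := fun f => match f with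
        | .t h _ _ => fun v => op h (v 0) (v 1) (v 2)
      RelMap := fun r _ => Empty.elim r }

/-- The algebra `L^{i,n}`. -/
def latAlg (L : Type) [Lattice L] (i n : ℕ) : Bundled.{0} (sig n).Structure :=
  ternaryAlg n L (latOp n i)

/-- The algebra `A^{i,n}`. -/
def boolAlg (A : Type) [BooleanAlgebra A] (i n : ℕ) : Bundled.{0} (sig n).Structure :=
  ternaryAlg n A (boolOp n i)

/-! ### The varieties. `Bool` is the two-element lattice and the two-element Boolean algebra. -/

/-- Generated by `C^{i,n}`, `i` odd, and `2^{i,n}`, `i` even, where `1 ≤ i ≤ ℓ = ⌊n/2⌋`. -/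
def Va (n : ℕ) : AlgClass (sig n) :=
  variety ({A | ∃ i, 1 ≤ i ∧ i ≤ n / 2 ∧ Odd i ∧ A = latAlg Bool i n} ∪
    {A | ∃ i, 1 ≤ i ∧ i ≤ n / 2 ∧ Even i ∧ A = boolAlg Bool i n})

/-- Generated by `2^{i,n}`, `i` odd, and `C^{i,n}`, `i` even, where `1 ≤ i ≤ ℓ`. -/
def Vb (n : ℕ) : AlgClass (sig n) :=
  variety ({A | ∃ i, 1 ≤ i ∧ i ≤ n / 2 ∧ Odd i ∧ A = boolAlg Bool i n} ∪
    {A | ∃ i, 1 ≤ i ∧ i ≤ n / 2 ∧ Even i ∧ A = latAlg Bool i n})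

/-- Generated by `C^{i,n}`, where `1 ≤ i ≤ ℓ`. -/
def Vc (n : ℕ) : AlgClass (sig n) :=
  variety {A | ∃ i, 1 ≤ i ∧ i ≤ n / 2 ∧ A = latAlg Bool i n}

/-- Generated by `2^{1,n}` and by `C^{i,n}`, where `2 ≤ i ≤ ℓ` (used for `n ≥ 4`). -/
def Vd (n : ℕ) : AlgClass (sig n) :=
  variety ({boolAlg Bool 1 n} ∪ {A | ∃ i, 2 ≤ i ∧ i ≤ n / 2 ∧ A = latAlg Bool i n})

/-- The non-indexed product of `Va n` and `Vb n`. -/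
def Ve (n : ℕ) : AlgClass (prodSig (sig n) (sig n)) :=
  varProd (Va n) (Vb n)

/-- The non-indexed product of `Vc n` and `Vd (n + 1)` (used for `n ≥ 3`). -/
def Vf (n : ℕ) : AlgClass (prodSig (sig n) (sig (n + 1))) :=
  varProd (Vc n) (Vd (n + 1))

/-! ### Conditions given by ternary terms -/

section Terms

variable {L : FirstOrder.Language.{0, 0}} (V : AlgClass L)

/-- `s(x,x,z) = t(x,x,z)` holds in `V`. -/
def EqLeft (s t : L.Term (Fin 3)) : Prop :=
  ∀ A ∈ V, ∀ x z : A, ev3 s x x z = ev3 t x x z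

/-- `s(x,z,z) = t(x,z,z)` holds in `V`. -/
def EqRight (s t : L.Term (Fin 3)) : Prop :=
  ∀ A ∈ V, ∀ x z : A, ev3 s x z z = ev3 t x z z

/-- `s(x,z,z) = t(x,x,z)` holds in `V`. -/
def EqForward (s t : L.Term (Fin 3)) : Prop :=
  ∀ A ∈ V, ∀ x z : A, ev3 s x z z = ev3 t x x z

/-- `s(x,x,z) = t(x,z,z)` holds in `V`. -/
def EqBackward (s t : L.Term (Fin 3)) : Prop :=
  ∀ A ∈ V, ∀ x z : A, ev3 s x x z = ev3 t x z z

/-- `t(x,y,x) = x` holds in `V`. -/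
def Absorbs (t : L.Term (Fin 3)) : Prop :=
  ∀ A ∈ V, ∀ x y : A, ev3 t x y x = x

/-- `t_0(x,y,z) = x` and `t_n(x,y,z) = z` hold in `V`. -/
def Ends (n : ℕ) (t : ℕ → L.Term (Fin 3)) : Prop :=
  ∀ A ∈ V, ∀ x y z : A, ev3 (t 0) x y z = x ∧ ev3 (t n) x y z = z

/-- `V` is `n`-distributive: it has Jónsson terms `t_0, …, t_n`. -/
def IsDistributive (n : ℕ) : Prop :=
  ∃ t : ℕ → L.Term (Fin 3), Ends V n t ∧ (∀ h ≤ n, Absorbs V (t h)) ∧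
    ∀ h < n, (Even h → EqLeft V (t h) (t (h + 1))) ∧ (Odd h → EqRight V (t h) (t (h + 1)))

/-- `V` is `n`-alvin: it has alvin terms `t_0, …, t_n`. -/
def IsAlvin (n : ℕ) : Prop :=
  ∃ t : ℕ → L.Term (Fin 3), Ends V n t ∧ (∀ h ≤ n, Absorbs V (t h)) ∧
    ∀ h < n, (Even h → EqRight V (t h) (t (h + 1))) ∧ (Odd h → EqLeft V (t h) (t (h + 1)))

/-- `V` is `n`-Gumm: as `n`-alvin, but `t_1(x,y,x) = x` is not required. -/
def IsGumm (n : ℕ) : Prop :=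
  ∃ t : ℕ → L.Term (Fin 3), Ends V n t ∧ (∀ h ≤ n, h ≠ 1 → Absorbs V (t h)) ∧
    ∀ h < n, (Even h → EqRight V (t h) (t (h + 1))) ∧ (Odd h → EqLeft V (t h) (t (h + 1)))

/-- `V` is `n`-directed-distributive: it has directed Jónsson terms `t_0, …, t_n`. -/
def IsDirectedDistributive (n : ℕ) : Prop :=
  ∃ t : ℕ → L.Term (Fin 3), Ends V n t ∧ (∀ h ≤ n, Absorbs V (t h)) ∧
    ∀ h < n, EqForward V (t h) (t (h + 1))

/-- `V` has mixed Jónsson terms `t_0, …, t_n`: for each `h < n`, at least one of the four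
equations holds throughout `V`. -/
def IsMixed (n : ℕ) : Prop :=
  ∃ t : ℕ → L.Term (Fin 3), Ends V n t ∧ (∀ h ≤ n, Absorbs V (t h)) ∧
    ∀ h < n, EqLeft V (t h) (t (h + 1)) ∨ EqRight V (t h) (t (h + 1)) ∨
      EqForward V (t h) (t (h + 1)) ∨ EqBackward V (t h) (t (h + 1))

/-- The equations for two-headed directed Gumm terms `p, t_2, …, t_{n-2}, q`. -/
def TwoHeadedTerms (n : ℕ) (p : L.Term (Fin 3)) (t : ℕ → L.Term (Fin 3))
    (q : L.Term (Fin 3)) : Prop :=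
  (∀ h, 2 ≤ h → h ≤ n - 2 → Absorbs V (t h)) ∧
  (∀ A ∈ V, ∀ x z : A, ev3 p x z z = x) ∧ EqLeft V p (t 2) ∧
  (∀ h, 2 ≤ h → h < n - 2 → EqForward V (t h) (t (h + 1))) ∧
  EqRight V (t (n - 2)) q ∧ (∀ A ∈ V, ∀ x z : A, ev3 q x x z = z)

/-- `V` is two-headed `n`-directed Gumm; this makes sense for `n ≥ 4` only. -/
def IsTwoHeadedDirectedGumm (n : ℕ) : Prop :=
  4 ≤ n ∧ ∃ p t q, TwoHeadedTerms V n p t q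

/-- `V` is `n`-directed with alvin heads; this makes sense for `n ≥ 4` only. -/
def IsDirectedAlvinHeads (n : ℕ) : Prop :=
  4 ≤ n ∧ ∃ p t q, TwoHeadedTerms V n p t q ∧ Absorbs V p ∧ Absorbs V q

/-! ### Conditions given by quaternary terms -/

/-- `u_0(x,y,z,w) = x`, `u_m(x,y,z,w) = w`, and `u_k(x,y,y,x) = x` for `k ≤ m` hold in `V`. -/
def DayBasic (m : ℕ) (u : ℕ → L.Term (Fin 4)) : Prop :=
  (∀ A ∈ V, ∀ x y z w : A, ev4 (u 0) x y z w = x ∧ ev4 (u m) x y z w = w) ∧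
  ∀ k ≤ m, ∀ A ∈ V, ∀ x y : A, ev4 (u k) x y y x = x

/-- `u(x,x,w,w) = v(x,x,w,w)` holds in `V`. -/
def DayOuter (u v : L.Term (Fin 4)) : Prop :=
  ∀ A ∈ V, ∀ x w : A, ev4 u x x w w = ev4 v x x w w

/-- `u(x,y,y,w) = v(x,y,y,w)` holds in `V`. -/
def DayInner (u v : L.Term (Fin 4)) : Prop :=
  ∀ A ∈ V, ∀ x y w : A, ev4 u x y y w = ev4 v x y y w

/-- `V` is `m`-modular: it has Day terms `u_0, …, u_m`. -/
def IsModular (m : ℕ) : Prop :=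
  ∃ u : ℕ → L.Term (Fin 4), DayBasic V m u ∧
    ∀ k < m, (Even k → DayOuter V (u k) (u (k + 1))) ∧ (Odd k → DayInner V (u k) (u (k + 1)))

/-- `V` is `m`-reversed-modular: it has reversed Day terms `u_0, …, u_m`. -/
def IsReversedModular (m : ℕ) : Prop :=
  ∃ u : ℕ → L.Term (Fin 4), DayBasic V m u ∧
    ∀ k < m, (Even k → DayInner V (u k) (u (k + 1))) ∧ (Odd k → DayOuter V (u k) (u (k + 1)))

end Terms

/-! ### Conditions given by congruence identities -/

/-- A congruence of the algebra `A`. -/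
structure Congruence {L : FirstOrder.Language.{0, 0}} (A : Bundled.{0} L.Structure) extends Setoid A where
  compat : ∀ {k : ℕ} (f : L.Functions k) (v w : Fin k → A), (∀ i, toSetoid (v i) (w i)) →
    toSetoid (FirstOrder.Language.Structure.funMap f v) (FirstOrder.Language.Structure.funMap f w)

/-- The underlying binary relation of a congruence. -/
def Congruence.rel {L : FirstOrder.Language.{0, 0}} {A : Bundled.{0} L.Structure} (α : Congruence A) :
    SetRel A A :=
  {p | α.toSetoid p.1 p.2}

/-- The `k`-fold relational composition `R ∘ R ∘ ⋯ ∘ R`, which is equality for `k = 0`. -/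
def relPow {A : Type} (R : SetRel A A) : ℕ → SetRel A A
  | 0 => SetRel.id
  | k + 1 => relPow R k ○ R

/-- With `ℓ = ⌊n/2⌋`, the congruence identity `α(β ∘ γ) ⊆ (α(γ ∘ β))^ℓ` for `n` even,
`α(β ∘ γ) ⊆ (α(γ ∘ β))^ℓ ∘ αγ` for `n` odd, holds in `V`. Here `○` is the relational product
in left-to-right order. -/
def IsSwitch {L : FirstOrder.Language.{0, 0}} (V : AlgClass L) (n : ℕ) : Prop :=
  ∀ A ∈ V, ∀ α β γ : Congruence A,
    (Even n → α.rel ∩ (β.rel ○ γ.rel) ⊆ relPow (α.rel ∩ (γ.rel ○ β.rel)) (n / 2)) ∧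
    (Odd n → α.rel ∩ (β.rel ○ γ.rel) ⊆
      relPow (α.rel ∩ (γ.rel ○ β.rel)) (n / 2) ○ (α.rel ∩ γ.rel))

/-- With `ℓ = ⌊n/2⌋`, the congruence identity `α(β ∘ γ) ⊆ αβ ∘ (α(γ ∘ β))^(ℓ-1) ∘ αγ` for `n`
even, `α(β ∘ γ) ⊆ αβ ∘ (α(γ ∘ β))^ℓ` for `n` odd, holds in `V`. As `ℓ - 1` occurs as an exponent,
`n = 0` is excluded. -/
def IsJSwitch {L : FirstOrder.Language.{0, 0}} (V : AlgClass L) (n : ℕ) : Prop :=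
  1 ≤ n ∧ ∀ A ∈ V, ∀ α β γ : Congruence A,
    (Even n → α.rel ∩ (β.rel ○ γ.rel) ⊆
      (α.rel ∩ β.rel) ○ relPow (α.rel ∩ (γ.rel ○ β.rel)) (n / 2 - 1) ○ (α.rel ∩ γ.rel)) ∧
    (Odd n → α.rel ∩ (β.rel ○ γ.rel) ⊆
      (α.rel ∩ β.rel) ○ relPow (α.rel ∩ (γ.rel ○ β.rel)) (n / 2))

/-- The level associated with a family of conditions `P 0, P 1, …` on `V` exists and equals `k`:
`k` is the smallest natural number `m` such that `V` satisfies `P m`. -/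
def HasLevel {L : FirstOrder.Language.{0, 0}} (P : AlgClass L → ℕ → Prop) (V : AlgClass L) (k : ℕ) : Prop :=
  IsLeast {m | P V m} k

end CongLevels

/-! Upper bounds. Substituting t_h into its own middle argument cancels the complement, so `dirTerm`
acts as the lattice operation in every generator, Boolean or not, and the lattice operations form
directed Jónsson terms (`isDirectedDistributive_gens`). If the first generator is Boolean, then t_1
and t_{n-1} serve as alvin heads around these terms (`isDirectedAlvinHeads_gens`). If n is even and
the kinds of generators alternate, then the t_h themselves are Jónsson or alvin terms. The remaining
upper bounds follow by general implications between the conditions, except that Vb for n = 2 needs a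
Pixley term.

Lower bounds. For n at least 3, every basic operation of the first generator lies below its first or
its third argument. Suppose that a term takes the value 1 there at several points, and that x_j is
the only variable which is 1 at all of them. Deleting the first generator, that is, passing from n +
2 to n by `star`, then turns the term into the projection to x_j (`evalB_star_eq_var`). The
absorption identities supply the point (1,0,0,1) or (1,0,1), and the ends of a chain of terms supply
a second point. So the outer terms of a chain for n + 2 collapse to projections, and a shorter chain
for n remains. A Day chain loses one link at each end whatever the first generator is. If the first
generator is a lattice, monotonicity makes a reversed Day chain lose three links at each end.
Induction from n = 2 and n = 3 refutes modularity at the required lengths (`not_isModular_gens`).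

The switch levels are treated in the same way (`HasSwitchTerms.reduce`, `HasJSwitchTerms.reduce`),
once the congruence identities have been turned into term conditions by means of the free algebra on
three generators. The other lower bounds come from these failures by the general implications. A
non-indexed product has the term conditions common to its factors, and its modularity and switch
conditions are inherited by both factors, so its levels can be read off from those of the factors.
-/

namespace CongLevels

open FirstOrder.Language (Term)

/-! ### Substitution and evaluation of terms -/

section Generic

variable {L : FirstOrder.Language.{0, 0}}

/-- The variable with index `i`. -/
abbrev tv {k : ℕ} (i : Fin k) : L.Term (Fin k) := Term.var i

/-- The composed term `t(a, b, c)`. -/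
def app3 {κ : Type} (t : L.Term (Fin 3)) (a b c : L.Term κ) : L.Term κ := t.subst ![a, b, c]

theorem realize_app3 {κ : Type} {A : Bundled.{0} L.Structure} (t : L.Term (Fin 3))
    (a b c : L.Term κ) (v : κ → A) :
    (app3 t a b c).realize v = ev3 t (a.realize v) (b.realize v) (c.realize v) := by
  unfold app3 ev3
  rw [Term.realize_subst]
  congr 1
  funext i
  fin_cases i <;> rfl

variable {A : Bundled.{0} L.Structure}

@[simp] theorem ev3_app3 (t a b c : L.Term (Fin 3)) (x y z : A) :
    ev3 (app3 t a b c) x y z = ev3 t (ev3 a x y z) (ev3 b x y z) (ev3 c x y z) :=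
  realize_app3 ..

@[simp] theorem ev4_app3 (t : L.Term (Fin 3)) (a b c : L.Term (Fin 4)) (x y z w : A) :
    ev4 (app3 t a b c) x y z w = ev3 t (ev4 a x y z w) (ev4 b x y z w) (ev4 c x y z w) :=
  realize_app3 ..

@[simp] theorem ev3_var0 (x y z : A) : ev3 (tv 0 : L.Term (Fin 3)) x y z = x := rfl
@[simp] theorem ev3_var2 (x y z : A) : ev3 (tv 2 : L.Term (Fin 3)) x y z = z := rfl
@[simp] theorem ev4_var0 (x y z w : A) : ev4 (tv 0 : L.Term (Fin 4)) x y z w = x := rfl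
@[simp] theorem ev4_var1 (x y z w : A) : ev4 (tv 1 : L.Term (Fin 4)) x y z w = y := rfl
@[simp] theorem ev4_var2 (x y z w : A) : ev4 (tv 2 : L.Term (Fin 4)) x y z w = z := rfl
@[simp] theorem ev4_var3 (x y z w : A) : ev4 (tv 3 : L.Term (Fin 4)) x y z w = w := rfl

variable {V : AlgClass L} {m n : ℕ}

/-! ### Monotonicity -/

theorem IsDistributive.mono (h : IsDistributive V m) (hmn : m ≤ n) : IsDistributive V n := by
  obtain ⟨t, hE, hA, hS⟩ := h
  refine ⟨fun k => t (min k m), fun A hA x y z => ?_, fun k _ => hA _ (min_le_right _ _),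
    fun k _ => ?_⟩
  · simpa [min_eq_right hmn] using hE A hA x y z
  · by_cases hk : k < m
    · simpa [min_eq_left hk.le, min_eq_left (Nat.succ_le_of_lt hk)] using hS k hk
    · dsimp only
      rw [min_eq_right (by omega : m ≤ k), min_eq_right (by omega : m ≤ k + 1)]
      exact ⟨fun _ _ _ _ _ => rfl, fun _ _ _ _ _ => rfl⟩

theorem IsAlvin.mono (h : IsAlvin V m) (hmn : m ≤ n) : IsAlvin V n := by
  obtain ⟨t, hE, hA, hS⟩ := h
  refine ⟨fun k => t (min k m), fun A hA x y z => ?_, fun k _ => hA _ (min_le_right _ _),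
    fun k _ => ?_⟩
  · simpa [min_eq_right hmn] using hE A hA x y z
  · by_cases hk : k < m
    · simpa [min_eq_left hk.le, min_eq_left (Nat.succ_le_of_lt hk)] using hS k hk
    · dsimp only
      rw [min_eq_right (by omega : m ≤ k), min_eq_right (by omega : m ≤ k + 1)]
      exact ⟨fun _ _ _ _ _ => rfl, fun _ _ _ _ _ => rfl⟩

/-- As in the other cases the last term is repeated, but here t_m(x,z,z) has to be compared with
t_m(x,x,z), which is where t_m = z enters. -/
theorem IsDirectedDistributive.mono (h : IsDirectedDistributive V m) (hmn : m ≤ n) :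
    IsDirectedDistributive V n := by
  obtain ⟨t, hE, hA, hS⟩ := h
  refine ⟨fun k => t (min k m), fun A hA x y z => ?_, fun k _ => hA _ (min_le_right _ _),
    fun k _ => ?_⟩
  · simpa [min_eq_right hmn] using hE A hA x y z
  · by_cases hk : k < m
    · simpa [min_eq_left hk.le, min_eq_left (Nat.succ_le_of_lt hk)] using hS k hk
    · dsimp only
      rw [min_eq_right (by omega : m ≤ k), min_eq_right (by omega : m ≤ k + 1)]
      intro A hA x z
      rw [(hE A hA _ _ _).2, (hE A hA _ _ _).2]

theorem DayBasic.extend {u : ℕ → L.Term (Fin 4)} (h : DayBasic V m u) (hmn : m ≤ n) :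
    DayBasic V n fun k => u (min k m) :=
  ⟨fun A hA x y z w => by simpa [min_eq_right hmn] using h.1 A hA x y z w,
    fun k _ => h.2 _ (min_le_right _ _)⟩

theorem IsModular.mono (h : IsModular V m) (hmn : m ≤ n) : IsModular V n := by
  obtain ⟨u, hB, hS⟩ := h
  refine ⟨_, hB.extend hmn, fun k _ => ?_⟩
  by_cases hk : k < m
  · simpa [min_eq_left hk.le, min_eq_left (Nat.succ_le_of_lt hk)] using hS k hk
  · rw [min_eq_right (by omega : m ≤ k), min_eq_right (by omega : m ≤ k + 1)]
    exact ⟨fun _ _ _ _ _ => rfl, fun _ _ _ _ _ _ => rfl⟩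

theorem IsReversedModular.mono (h : IsReversedModular V m) (hmn : m ≤ n) :
    IsReversedModular V n := by
  obtain ⟨u, hB, hS⟩ := h
  refine ⟨_, hB.extend hmn, fun k _ => ?_⟩
  by_cases hk : k < m
  · simpa [min_eq_left hk.le, min_eq_left (Nat.succ_le_of_lt hk)] using hS k hk
  · rw [min_eq_right (by omega : m ≤ k), min_eq_right (by omega : m ≤ k + 1)]
    exact ⟨fun _ _ _ _ _ _ => rfl, fun _ _ _ _ _ => rfl⟩

/-! ### Shifts by one -/

/-- The sequence `a, t 0, t 1, …`. -/
def prepend {T : Type} (a : T) (t : ℕ → T) : ℕ → T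
  | 0 => a
  | k + 1 => t k

theorem Ends.prepend {t : ℕ → L.Term (Fin 3)} (h : Ends V n t) :
    Ends V (n + 1) (prepend (tv 0) t) :=
  fun A hA x y z => ⟨rfl, (h A hA x y z).2⟩

/-- Prepending the first projection shifts all indices by one and so exchanges the roles of even and
odd. -/
theorem IsDistributive.isAlvin (h : IsDistributive V n) : IsAlvin V (n + 1) := by
  obtain ⟨t, hE, hA, hS⟩ := h
  refine ⟨prepend (tv 0) t, hE.prepend, ?_, ?_⟩
  · rintro (_ | k) hk
    · exact fun _ _ _ _ => rfl
    · exact hA k (by omega)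
  · rintro (_ | k) hk
    · exact ⟨fun _ A hA x z => (hE A hA x z z).1.symm, fun h => by simp at h⟩
    · exact ⟨fun h => (hS k (by omega)).2 (by grind), fun h => (hS k (by omega)).1 (by grind)⟩

theorem IsAlvin.isDistributive (h : IsAlvin V n) : IsDistributive V (n + 1) := by
  obtain ⟨t, hE, hA, hS⟩ := h
  refine ⟨prepend (tv 0) t, hE.prepend, ?_, ?_⟩
  · rintro (_ | k) hk
    · exact fun _ _ _ _ => rfl
    · exact hA k (by omega)
  · rintro (_ | k) hk
    · exact ⟨fun _ A hA x z => (hE A hA x x z).1.symm, fun h => by simp at h⟩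
    · exact ⟨fun h => (hS k (by omega)).2 (by grind), fun h => (hS k (by omega)).1 (by grind)⟩

theorem DayBasic.prepend {u : ℕ → L.Term (Fin 4)} (h : DayBasic V n u) :
    DayBasic V (n + 1) (prepend (tv 0) u) := by
  refine ⟨fun A hA x y z w => ⟨rfl, (h.1 A hA x y z w).2⟩, ?_⟩
  rintro (_ | k) hk
  · exact fun _ _ _ _ => rfl
  · exact h.2 k (by omega)

theorem IsModular.isReversedModular (h : IsModular V n) : IsReversedModular V (n + 1) := by
  obtain ⟨u, hB, hS⟩ := h
  refine ⟨_, hB.prepend, ?_⟩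
  rintro (_ | k) hk
  · exact ⟨fun _ A hA x y w => (hB.1 A hA x y y w).1.symm, fun h => by simp at h⟩
  · exact ⟨fun h => (hS k (by omega)).2 (by grind), fun h => (hS k (by omega)).1 (by grind)⟩

theorem IsReversedModular.isModular (h : IsReversedModular V n) : IsModular V (n + 1) := by
  obtain ⟨u, hB, hS⟩ := h
  refine ⟨_, hB.prepend, ?_⟩
  rintro (_ | k) hk
  · exact ⟨fun _ A hA x w => (hB.1 A hA x x w w).1.symm, fun h => by simp at h⟩
  · exact ⟨fun h => (hS k (by omega)).2 (by grind), fun h => (hS k (by omega)).1 (by grind)⟩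

/-! ### Consequences of directed and mixed Jónsson terms -/

theorem IsDirectedDistributive.isMixed (h : IsDirectedDistributive V n) : IsMixed V n := by
  obtain ⟨t, hE, hA, hS⟩ := h
  exact ⟨t, hE, hA, fun k hk => .inr (.inr (.inl (hS k hk)))⟩

/-- Interpolating t_h(x,z,z) between t_h and t_{h+1} splits each forward link into a right link and
a left one. The ends cost nothing: t_0(x,z,z) is x, and t_{n-1}(x,z,z) is already z. -/
theorem IsDirectedDistributive.isDistributive (h : IsDirectedDistributive V n) (hn : 1 ≤ n) :
    IsDistributive V (2 * n - 2) := by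
  obtain ⟨t, hE, hA, hS⟩ := h
  refine ⟨fun k => if Even k then app3 (t (k / 2)) (tv 0) (tv 2) (tv 2) else t ((k + 1) / 2),
    ?_, ?_, ?_⟩
  · intro A hA x y z
    have h1 := hS (n - 1) (by omega) A hA x z
    rw [show n - 1 + 1 = n by omega, (hE A hA x x z).2] at h1
    simp [(hE A hA x z z).1, show Even (2 * n - 2) by grind, show (2 * n - 2) / 2 = n - 1 by omega,
      h1]
  · intro k hk A hV x y
    by_cases he : Even k
    · simp [he, hA (k / 2) (by omega) A hV]
    · simp [he, hA ((k + 1) / 2) (by omega) A hV]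
  · intro k hk
    refine ⟨fun he A hV x z => ?_, fun ho A hV x z => ?_⟩
    · simp [he, show ¬ Even (k + 1) by grind, hS (k / 2) (by omega) A hV,
        show (k + 1 + 1) / 2 = k / 2 + 1 by omega]
    · simp [show ¬ Even k by grind, show Even (k + 1) by grind]

/-- Each t_h occurs twice, as t_h(x,·,w) with y or z in the middle, except for one occurrence of t_0
and of t_n. Under y = z the two copies coincide; under x = y and z = w the chosen middle variables
turn the link between t_h and t_{h+1} into whichever of the four identities is available. -/
theorem IsMixed.isModular (h : IsMixed V n) : IsModular V (2 * n - 1) := by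
  obtain ⟨t, hE, hA, hS⟩ := h
  rcases Nat.eq_zero_or_pos n with rfl | hn
  · refine ⟨fun _ => tv 0, ⟨fun A hA x y z w => ⟨rfl, ?_⟩, fun _ _ _ _ _ _ => rfl⟩, by simp⟩
    exact ((hE A hA x y w).1.symm.trans (hE A hA x y w).2)
  -- The flags `o h` and `i h` record whether the middle argument is z rather than x when t_h is
  -- left and when t_{h+1} is entered.
  have key : ∀ h, ∃ o i : Bool, h < n → ∀ A ∈ V, ∀ x z : A,
      ev3 (t h) x (bif o then z else x) z = ev3 (t (h + 1)) x (bif i then z else x) z := by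
    intro h
    by_cases hh : h < n
    · rcases hS h hh with h1 | h1 | h1 | h1
      · exact ⟨false, false, fun _ => h1⟩
      · exact ⟨true, true, fun _ => h1⟩
      · exact ⟨true, false, fun _ => h1⟩
      · exact ⟨false, true, fun _ => h1⟩
    · exact ⟨true, true, fun h => absurd h hh⟩
  choose o i hoi using key
  refine ⟨fun k => if Even k
    then app3 (t (k / 2)) (tv 0) (bif o (k / 2) then tv 2 else tv 1) (tv 3)
    else app3 (t (k / 2 + 1)) (tv 0) (bif i (k / 2) then tv 2 else tv 1) (tv 3), ⟨?_, ?_⟩, ?_⟩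
  · intro A hA x y z w
    simp [(hE A hA _ _ _).1, (hE A hA _ _ _).2, show ¬ Even (2 * n - 1) by grind,
      show (2 * n - 1) / 2 + 1 = n by omega]
  · intro k hk A hV x y
    by_cases he : Even k
    · simp [he, hA (k / 2) (by omega) A hV]
    · simp [he, hA (k / 2 + 1) (by grind) A hV]
  · intro k hk
    refine ⟨fun he A hV x w => ?_, fun ho A hV x y w => ?_⟩
    · have := hoi (k / 2) (by omega) A hV x w
      simp only [he, show ¬ Even (k + 1) by grind, show (k + 1) / 2 = k / 2 by grind, if_true,
        if_false, ev4_app3]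
      cases h1 : o (k / 2) <;> cases h2 : i (k / 2) <;> simpa [h1, h2] using this
    · simp only [show ¬ Even k by grind, show Even (k + 1) by grind,
        show (k + 1) / 2 = k / 2 + 1 by grind, if_true, if_false, ev4_app3]
      cases h1 : o (k / 2 + 1) <;> cases h2 : i (k / 2) <;> simp

/-! ### Two-headed terms -/

/-- Projections serve as heads, and the middle terms are t_1, …, t_{n-1} with indices raised by one.
-/
theorem IsDirectedDistributive.isDirectedAlvinHeads (h : IsDirectedDistributive V n)
    (hn : 2 ≤ n) : IsDirectedAlvinHeads V (n + 2) := by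
  obtain ⟨t, hE, hA, hS⟩ := h
  refine ⟨by omega, tv 0, fun k => t (k - 1), tv 2, ⟨?_, ?_, ?_, ?_, ?_, ?_⟩, ?_, ?_⟩
  · exact fun h _ _ => hA _ (by omega)
  · exact fun _ _ _ _ => rfl
  · intro A hA x z
    rw [← hS 0 (by omega) A hA, (hE A hA _ _ _).1, ev3_var0]
  · intro h h2 hh
    have := hS (h - 1) (by omega)
    rwa [show h - 1 + 1 = h + 1 - 1 by omega] at this
  · intro A hA x z
    dsimp only
    rw [show n + 2 - 2 - 1 = n - 1 by omega, hS (n - 1) (by omega) A hA,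
      show n - 1 + 1 = n by omega, (hE A hA _ _ _).2, ev3_var2]
  · exact fun _ _ _ _ => rfl
  · exact fun _ _ _ _ => rfl
  · exact fun _ _ _ _ => rfl

theorem IsDirectedAlvinHeads.isTwoHeadedDirectedGumm (h : IsDirectedAlvinHeads V n) :
    IsTwoHeadedDirectedGumm V n :=
  ⟨h.1, by obtain ⟨p, t, q, hT, -⟩ := h.2; exact ⟨p, t, q, hT⟩⟩

/-- The added middle term is t_{n-2}(x,z,z). It does not depend on y, so it can be entered from
t_{n-2} and left towards q. -/
theorem IsDirectedAlvinHeads.succ (h : IsDirectedAlvinHeads V n) :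
    IsDirectedAlvinHeads V (n + 1) := by
  obtain ⟨hn, p, t, q, ⟨hA, hp, hp2, hF, hq2, hq⟩, hpA, hqA⟩ := h
  refine ⟨by omega, p, fun h => if h ≤ n - 2 then t h else app3 (t (n - 2)) (tv 0) (tv 2) (tv 2),
    q, ⟨?_, hp, ?_, ?_, ?_, hq⟩, hpA, hqA⟩
  · intro h h2 hh A hV x y
    by_cases hc : h ≤ n - 2
    · simpa [hc] using hA h h2 hc A hV x y
    · simpa [hc] using hA (n - 2) (by omega) le_rfl A hV x x
  · dsimp only
    rwa [if_pos (by omega)]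
  · intro h h2 hh A hV x z
    by_cases hc : h < n - 2
    · simpa [hc.le, Nat.succ_le_of_lt hc] using hF h h2 hc A hV x z
    · obtain rfl : h = n - 2 := by omega
      simp
  · intro A hV x z
    simpa [show ¬ n ≤ n - 2 + 1 by omega] using hq2 A hV x z

/-- The chain is x, p, t_2(x,y,z), t_2(x,z,z), t_3(x,y,z), …, t_{n-2}(x,y,z), q, z. The copy
t_{n-2}(x,z,z) is omitted because q is reached from t_{n-2} by a right link. -/
theorem IsDirectedAlvinHeads.isAlvin (h : IsDirectedAlvinHeads V n) : IsAlvin V (2 * n - 4) := by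
  obtain ⟨hn, p, t, q, ⟨hA, hp, hp2, hF, hq2, hq⟩, hpA, hqA⟩ := h
  refine ⟨fun k => if k = 0 then tv 0 else if k = 1 then p else if k = 2 * n - 4 then tv 2
    else if k = 2 * n - 5 then q else if Even k then t (k / 2 + 1)
    else app3 (t (k / 2 + 1)) (tv 0) (tv 2) (tv 2), ?_, ?_, ?_⟩
  · intro A hA x y z
    simp [show 2 * n - 4 ≠ 0 by omega, show 2 * n - 4 ≠ 1 by omega]
  · intro k hk
    dsimp only
    split_ifs with h0 h1 h2 h3 h4
    · exact fun _ _ _ _ => rfl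
    · exact hpA
    · exact fun _ _ _ _ => rfl
    · exact hqA
    · exact hA _ (by omega) (by grind)
    · intro A hV x y
      simpa using hA (k / 2 + 1) (by omega) (by grind) A hV x x
  · intro k hk
    by_cases h0 : k = 0
    · subst h0
      simpa [EqRight] using fun A hA x z => (hp A hA x z).symm
    by_cases h1 : k = 1
    · subst h1
      refine ⟨fun h => by simp at h, fun _ => ?_⟩
      by_cases h4 : n = 4
      · subst h4
        simpa using hp2
      · simpa [show 2 ≠ 2 * n - 4 by omega, show 2 ≠ 2 * n - 5 by omega] using hp2
    by_cases h5 : k = 2 * n - 5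
    · refine ⟨fun h => by grind, fun _ A hV x z => ?_⟩
      simp [h5, show 2 * n - 5 ≠ 2 * n - 4 by omega, show 2 * n - 5 + 1 = 2 * n - 4 by omega,
        show 2 * n - 5 ≠ 0 by omega, show 2 * n - 5 ≠ 1 by omega, show 2 * n - 4 ≠ 0 by omega,
        show 2 * n - 4 ≠ 1 by omega, hq A hV x z]
    by_cases h6 : k = 2 * n - 6
    · refine ⟨fun h A hV x z => ?_, fun h => by grind⟩
      simp [h6, show 2 * n - 6 ≠ 2 * n - 4 by omega, show 2 * n - 6 + 1 = 2 * n - 5 by omega,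
        show 2 * n - 6 ≠ 2 * n - 5 by omega, show Even (2 * n - 6) by grind,
        show 2 * n - 5 ≠ 0 by omega, show 2 * n - 5 ≠ 1 by omega, show 2 * n - 6 ≠ 0 by omega,
        show 2 * n - 5 ≠ 2 * n - 4 by omega, show (2 * n - 6) / 2 + 1 = n - 2 by omega,
        show 2 * n - 6 ≠ 1 by omega, hq2 A hV x z]
    have h4 : k ≠ 2 * n - 4 := by omega
    have h4' : k + 1 ≠ 2 * n - 4 := by omega
    have h5' : k + 1 ≠ 2 * n - 5 := by omega
    refine ⟨fun he A hV x z => ?_, fun ho A hV x z => ?_⟩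
    · simp [h0, h1, h4, h5, h4', h5', he, show ¬ Even (k + 1) by grind,
        show (k + 1) / 2 = k / 2 by grind]
    · have := hF (k / 2 + 1) (by omega) (by grind) A hV x z
      simp [h0, h1, h4, h5, h4', h5', show ¬ Even k by grind, show Even (k + 1) by grind,
        show (k + 1) / 2 = k / 2 + 1 by grind, this]

/-- The heads are used as p(x,y,z) and q(y,z,w). For y = z and x = w, absorption then only requires
p(x,y,y) = x and q(y,y,x) = x, so absorbing heads are not needed. -/
theorem IsTwoHeadedDirectedGumm.isReversedModular (h : IsTwoHeadedDirectedGumm V n) :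
    IsReversedModular V (2 * n - 3) := by
  obtain ⟨hn, p, t, q, ⟨hA, hp, hp2, hF, hq2, hq⟩⟩ := h
  have hpi : ∀ A ∈ V, ∀ x : A, ev3 p x x x = x := fun A hV x => hp A hV x x
  refine ⟨fun k => if k = 0 then tv 0 else if k = 1 then app3 p (tv 0) (tv 1) (tv 2)
    else if k = 2 * n - 4 then app3 q (tv 1) (tv 2) (tv 3) else if k = 2 * n - 3 then tv 3
    else if Even k then app3 (t (k / 2 + 1)) (tv 0) (tv 1) (tv 3)
    else app3 (t (k / 2 + 1)) (tv 0) (tv 2) (tv 3), ⟨?_, ?_⟩, ?_⟩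
  · intro A hA x y z w
    simp [show 2 * n - 3 ≠ 0 by omega, show 2 * n - 3 ≠ 1 by omega,
      show 2 * n - 3 ≠ 2 * n - 4 by omega]
  · intro k hk A hV x y
    dsimp only
    split_ifs with h0 h1 h2 h3 h4
    · rfl
    · simp [hp A hV]
    · simp [hq A hV]
    · rfl
    · simpa using hA _ (by omega) (by grind) A hV x y
    · simpa using hA (k / 2 + 1) (by omega) (by grind) A hV x y
  · intro k hk
    by_cases h0 : k = 0
    · subst h0
      simpa [DayInner] using fun A hA x y _ => (hp A hA x y).symm
    by_cases h1 : k = 1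
    · subst h1
      refine ⟨fun h => by simp at h, fun _ A hV x w => ?_⟩
      simp [show 2 ≠ 2 * n - 4 by omega, show 2 ≠ 2 * n - 3 by omega, hp2 A hV]
    by_cases h5 : k = 2 * n - 4
    · refine ⟨fun _ A hV x y w => ?_, fun h => by grind⟩
      simp [h5, show 2 * n - 4 + 1 = 2 * n - 3 by omega,
        show 2 * n - 3 ≠ 2 * n - 4 by omega,
        show 2 * n - 3 ≠ 0 by omega, show 2 * n - 3 ≠ 1 by omega, show 2 * n - 4 ≠ 0 by omega,
        show 2 * n - 4 ≠ 1 by omega, hq A hV]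
    by_cases h6 : k = 2 * n - 5
    · refine ⟨fun h => by grind, fun h A hV x z => ?_⟩
      simp [h6, show 2 * n - 5 + 1 = 2 * n - 4 by omega,
        show 2 * n - 5 ≠ 2 * n - 4 by omega, show ¬ Even (2 * n - 5) by grind,
        show 2 * n - 5 ≠ 2 * n - 3 by omega,
        show 2 * n - 5 ≠ 0 by omega, show 2 * n - 5 ≠ 1 by omega,
        show 2 * n - 4 ≠ 0 by omega, show 2 * n - 4 ≠ 1 by omega,
        show (2 * n - 5) / 2 + 1 = n - 2 by omega, hq2 A hV x z]
    have h4 : k ≠ 2 * n - 3 := by omega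
    have h4' : k + 1 ≠ 2 * n - 4 := by omega
    have h5' : k + 1 ≠ 2 * n - 3 := by omega
    refine ⟨fun he A hV x y w => ?_, fun ho A hV x w => ?_⟩
    · simp [h0, h1, h4, h5, h4', h5', he, show ¬ Even (k + 1) by grind,
        show (k + 1) / 2 = k / 2 by grind]
    · have := hF (k / 2 + 1) (by omega) (by grind) A hV x w
      simp [h0, h1, h4, h5, h4', h5', show ¬ Even k by grind, show Even (k + 1) by grind,
        show (k + 1) / 2 = k / 2 + 1 by grind, this]

end Generic

/-! ### Relational powers and congruence identities -/

theorem relPow_succ_of_mem {A : Type} {R : SetRel A A} {k : ℕ} {a b c : A} (hab : (a, b) ∈ relPow R k)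
    (hbc : (b, c) ∈ R) : (a, c) ∈ relPow R (k + 1) :=
  ⟨b, hab, hbc⟩

theorem relPow_succ_of_mem' {A : Type} {R : SetRel A A} {k : ℕ} {a b c : A} (hab : (a, b) ∈ R)
    (hbc : (b, c) ∈ relPow R k) : (a, c) ∈ relPow R (k + 1) := by
  induction k generalizing c with
  | zero =>
    obtain rfl : b = c := hbc
    exact ⟨a, rfl, hab⟩
  | succ k ih =>
    obtain ⟨d, hd, hdc⟩ := hbc
    exact ⟨d, ih hd, hdc⟩

theorem exists_seq_of_mem_relPow {A : Type} {R : SetRel A A} {k : ℕ} {a b : A}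
    (hab : (a, b) ∈ relPow R k) :
    ∃ f : ℕ → A, f 0 = a ∧ f k = b ∧ ∀ j < k, (f j, f (j + 1)) ∈ R := by
  induction k generalizing b with
  | zero => exact ⟨fun _ => a, rfl, hab, by simp⟩
  | succ k ih =>
    obtain ⟨c, hc, hcb⟩ := hab
    obtain ⟨f, h0, hk, hf⟩ := ih hc
    refine ⟨fun j => if j ≤ k then f j else b, by simpa using h0, by simp, fun j hj => ?_⟩
    rcases Nat.lt_succ_iff_lt_or_eq.mp hj with h | rfl
    · simpa [h.le, Nat.succ_le_of_lt h] using hf j h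
    · simpa [hk] using hcb

section Generic

variable {L : FirstOrder.Language.{0, 0}} {A : Bundled.{0} L.Structure} {V : AlgClass L} {m n : ℕ}

theorem Congruence.realize (α : Congruence A) {κ : Type} (t : L.Term κ) {v w : κ → A}
    (h : ∀ i, (v i, w i) ∈ α.rel) : (t.realize v, t.realize w) ∈ α.rel := by
  induction t with
  | var i => exact h i
  | func f ts ih => exact α.compat f _ _ ih

theorem Congruence.ev3 (α : Congruence A) (t : L.Term (Fin 3)) {x y z x' y' z' : A}
    (hx : (x, x') ∈ α.rel) (hy : (y, y') ∈ α.rel) (hz : (z, z') ∈ α.rel) :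
    (ev3 t x y z, ev3 t x' y' z') ∈ α.rel := by
  refine α.realize t fun i => ?_
  fin_cases i
  exacts [hx, hy, hz]

theorem Congruence.refl' (α : Congruence A) (a : A) : (a, a) ∈ α.rel := α.toSetoid.refl a

theorem Congruence.symm' (α : Congruence A) {a b : A} (h : (a, b) ∈ α.rel) : (b, a) ∈ α.rel :=
  α.toSetoid.symm h

theorem Congruence.trans' (α : Congruence A) {a b c : A} (h : (a, b) ∈ α.rel)
    (h' : (b, c) ∈ α.rel) : (a, c) ∈ α.rel :=
  α.toSetoid.trans h h'

/-- Modulo γ the middle argument may be replaced by c, where the two terms agree. -/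
theorem EqRight.mem_rel {s t : L.Term (Fin 3)} (h : EqRight V s t) (hA : A ∈ V) (γ : Congruence A)
    {a b c : A} (hbc : (b, c) ∈ γ.rel) : (CongLevels.ev3 s a b c, CongLevels.ev3 t a b c) ∈ γ.rel := by
  refine γ.trans' (γ.ev3 s (γ.refl' a) hbc (γ.refl' c)) ?_
  rw [h A hA]
  exact γ.ev3 t (γ.refl' a) (γ.symm' hbc) (γ.refl' c)

theorem EqLeft.mem_rel {s t : L.Term (Fin 3)} (h : EqLeft V s t) (hA : A ∈ V) (β : Congruence A)
    {a b c : A} (hab : (a, b) ∈ β.rel) : (CongLevels.ev3 s a b c, CongLevels.ev3 t a b c) ∈ β.rel := by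
  refine β.trans' (β.ev3 s (β.refl' a) (β.symm' hab) (β.refl' c)) ?_
  rw [h A hA]
  exact β.ev3 t (β.refl' a) hab (β.refl' c)

theorem Absorbs.mem_rel {s : L.Term (Fin 3)} (h : Absorbs V s) (hA : A ∈ V) (α : Congruence A)
    {a b c : A} (hac : (a, c) ∈ α.rel) : (CongLevels.ev3 s a b c, a) ∈ α.rel := by
  have := α.ev3 s (α.refl' a) (α.refl' b) (α.symm' hac)
  rwa [h A hA] at this

theorem Absorbs.mem_rel₂ {s t : L.Term (Fin 3)} (hs : Absorbs V s) (ht : Absorbs V t) (hA : A ∈ V)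
    (α : Congruence A) {a b c : A} (hac : (a, c) ∈ α.rel) :
    (CongLevels.ev3 s a b c, CongLevels.ev3 t a b c) ∈ α.rel :=
  α.trans' (hs.mem_rel hA α hac) (α.symm' (ht.mem_rel hA α hac))

theorem IsAlvin.isGumm (h : IsAlvin V n) : IsGumm V n := by
  obtain ⟨t, hE, hA, hS⟩ := h
  exact ⟨t, hE, fun k hk _ => hA k hk, hS⟩

/-- Two links, γ followed by β, form one factor α(γ ∘ β). Only the terms of even index must be
α-related, so absorption of t_1 is never used, and the Gumm condition suffices. -/
theorem IsGumm.isSwitch (h : IsGumm V n) : IsSwitch V n := by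
  obtain ⟨t, hE, hAb, hS⟩ := h
  intro A hA α β γ
  have key : ∀ a b c : A, (a, c) ∈ α.rel → (a, b) ∈ β.rel → (b, c) ∈ γ.rel → ∀ j, 2 * j ≤ n →
      (a, ev3 (t (2 * j)) a b c) ∈ relPow (α.rel ∩ (γ.rel ○ β.rel)) j := by
    intro a b c hac hab hbc j
    induction j with
    | zero => exact fun _ => (hE A hA a b c).1.symm
    | succ j ih =>
      intro hj
      refine relPow_succ_of_mem (ih (by omega)) ⟨?_, ev3 (t (2 * j + 1)) a b c, ?_, ?_⟩
      · exact (hAb _ (by omega) (by omega)).mem_rel₂ (hAb _ hj (by omega)) hA α hac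
      · exact ((hS (2 * j) (by omega)).1 (by simp)).mem_rel hA γ hbc
      · exact ((hS (2 * j + 1) (by omega)).2 (by simp)).mem_rel hA β hab
  refine ⟨fun hn => ?_, fun hn => ?_⟩
  · rintro ⟨a, c⟩ ⟨hac, b, hab, hbc⟩
    have := key a b c hac hab hbc (n / 2) (by omega)
    rwa [show 2 * (n / 2) = n by grind, (hE A hA a b c).2] at this
  · rintro ⟨a, c⟩ ⟨hac, b, hab, hbc⟩
    refine ⟨_, key a b c hac hab hbc (n / 2) (by omega), ?_⟩
    have h1 : (2 * (n / 2)) + 1 = n := by grind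
    have h2 := (hAb (2 * (n / 2)) (by omega) (by omega)).mem_rel (b := b) hA α hac
    have h3 := ((hS (2 * (n / 2)) (by omega)).1 (by simp)).mem_rel (a := a) hA γ hbc
    rw [h1, (hE A hA a b c).2] at h3
    exact ⟨α.trans' h2 hac, h3⟩

/-- The links are paired starting from t_1. The link from t_0 to t_1 gives the factor αβ, and for
even n one unpaired link gives αγ at the end. -/
theorem IsDistributive.isJSwitch (h : IsDistributive V n) (hn1 : 1 ≤ n) : IsJSwitch V n := by
  refine ⟨hn1, ?_⟩
  obtain ⟨t, hE, hAb, hS⟩ := h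
  intro A hA α β γ
  have key : ∀ a b c : A, (a, c) ∈ α.rel → (a, b) ∈ β.rel → (b, c) ∈ γ.rel → ∀ j, 2 * j + 1 ≤ n →
      (ev3 (t 1) a b c, ev3 (t (2 * j + 1)) a b c) ∈ relPow (α.rel ∩ (γ.rel ○ β.rel)) j := by
    intro a b c hac hab hbc j
    induction j with
    | zero => exact fun _ => rfl
    | succ j ih =>
      intro hj
      refine relPow_succ_of_mem (ih (by omega)) ⟨?_, ev3 (t (2 * j + 2)) a b c, ?_, ?_⟩
      · exact (hAb _ (by omega)).mem_rel₂ (hAb _ hj) hA α hac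
      · exact ((hS (2 * j + 1) (by omega)).2 (by simp)).mem_rel hA γ hbc
      · exact ((hS (2 * j + 2) (by omega)).1 (by simp [parity_simps])).mem_rel hA β hab
  have first : ∀ a b c : A, (a, c) ∈ α.rel → (a, b) ∈ β.rel → (a, ev3 (t 1) a b c) ∈ α.rel ∩ β.rel := by
    intro a b c hac hab
    have h3 := ((hS 0 (by omega)).1 (by simp)).mem_rel (c := c) hA β hab
    rw [(hE A hA a b c).1] at h3
    exact ⟨α.symm' ((hAb 1 hn1).mem_rel hA α hac), h3⟩
  refine ⟨fun hn => ?_, fun hn => ?_⟩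
  · rintro ⟨a, c⟩ ⟨hac, b, hab, hbc⟩
    refine ⟨ev3 (t (n - 1)) a b c, ⟨_, first a b c hac hab, ?_⟩, ?_⟩
    · have := key a b c hac hab hbc (n / 2 - 1) (by grind)
      rwa [show 2 * (n / 2 - 1) + 1 = n - 1 by grind] at this
    · have h2 := (hAb (n - 1) (by omega)).mem_rel (b := b) hA α hac
      have h3 := ((hS (n - 1) (by omega)).2 (by grind)).mem_rel (a := a) hA γ hbc
      rw [show n - 1 + 1 = n by omega, (hE A hA a b c).2] at h3
      exact ⟨α.trans' h2 hac, h3⟩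
  · rintro ⟨a, c⟩ ⟨hac, b, hab, hbc⟩
    refine ⟨_, first a b c hac hab, ?_⟩
    have := key a b c hac hab hbc (n / 2) (by grind)
    rwa [show 2 * (n / 2) + 1 = n by grind, (hE A hA a b c).2] at this

theorem mem_inter_comp_of_left {α β γ : Congruence A} {a b : A} (h : (a, b) ∈ α.rel ∩ γ.rel) :
    (a, b) ∈ α.rel ∩ (γ.rel ○ β.rel) :=
  ⟨h.1, b, h.2, β.refl' b⟩

theorem mem_inter_comp_of_right {α β γ : Congruence A} {a b : A} (h : (a, b) ∈ α.rel ∩ β.rel) :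
    (a, b) ∈ α.rel ∩ (γ.rel ○ β.rel) :=
  ⟨h.1, a, γ.refl' a, h.2⟩

theorem IsSwitch.isJSwitch (h : IsSwitch V n) : IsJSwitch V (n + 1) := by
  refine ⟨by omega, fun A hA α β γ => ⟨fun hn ac hac => ?_, fun hn ac hac => ?_⟩⟩
  · have hn' : Odd n := by grind
    obtain ⟨b, h1, h2⟩ := (h A hA α β γ).2 hn' hac
    refine ⟨b, ⟨ac.1, ⟨α.refl' _, β.refl' _⟩, ?_⟩, h2⟩
    rwa [show (n + 1) / 2 - 1 = n / 2 by grind]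
  · have hn' : Even n := by grind
    refine ⟨ac.1, ⟨α.refl' _, β.refl' _⟩, ?_⟩
    rw [show (n + 1) / 2 = n / 2 by grind]
    exact (h A hA α β γ).1 hn' hac

/-- The initial factor αβ is contained in α(γ ∘ β) and is counted as a further factor of the power.
-/
theorem IsJSwitch.isSwitch (h : IsJSwitch V n) : IsSwitch V (n + 1) := by
  refine fun A hA α β γ => ⟨fun hn ac hac => ?_, fun hn ac hac => ?_⟩
  · have hn' : Odd n := by grind
    obtain ⟨b, h1, h2⟩ := (h.2 A hA α β γ).2 hn' hac
    rw [show (n + 1) / 2 = n / 2 + 1 by grind]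
    exact relPow_succ_of_mem' (mem_inter_comp_of_right h1) h2
  · have hn' : Even n := by grind
    obtain ⟨b, ⟨c, h1, h2⟩, h3⟩ := (h.2 A hA α β γ).1 hn' hac
    refine ⟨b, ?_, h3⟩
    have := h.1
    rw [show (n + 1) / 2 = n / 2 - 1 + 1 by grind]
    exact relPow_succ_of_mem' (mem_inter_comp_of_right h1) h2

theorem IsSwitch.succ (h : IsSwitch V n) : IsSwitch V (n + 1) := by
  refine fun A hA α β γ => ⟨fun hn ac hac => ?_, fun hn ac hac => ?_⟩
  · have hn' : Odd n := by grind
    obtain ⟨b, h1, h2⟩ := (h A hA α β γ).2 hn' hac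
    rw [show (n + 1) / 2 = n / 2 + 1 by grind]
    exact relPow_succ_of_mem h1 (mem_inter_comp_of_left h2)
  · have hn' : Even n := by grind
    rw [show (n + 1) / 2 = n / 2 by grind]
    exact ⟨ac.2, (h A hA α β γ).1 hn' hac, α.refl' _, γ.refl' _⟩

theorem IsJSwitch.succ (h : IsJSwitch V n) : IsJSwitch V (n + 1) := by
  have h1 := h.1
  refine ⟨by omega, fun A hA α β γ => ⟨fun hn ac hac => ?_, fun hn ac hac => ?_⟩⟩
  · have hn' : Odd n := by grind
    rw [show (n + 1) / 2 - 1 = n / 2 by grind]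
    exact ⟨ac.2, (h.2 A hA α β γ).2 hn' hac, α.refl' _, γ.refl' _⟩
  · have hn' : Even n := by grind
    obtain ⟨b, ⟨c, h1, h2⟩, h3⟩ := (h.2 A hA α β γ).1 hn' hac
    refine ⟨c, h1, ?_⟩
    rw [show (n + 1) / 2 = n / 2 - 1 + 1 by grind]
    exact relPow_succ_of_mem h2 (mem_inter_comp_of_left h3)

theorem IsSwitch.mono (h : IsSwitch V m) (hmn : m ≤ n) : IsSwitch V n := by
  induction hmn with
  | refl => exact h
  | step _ ih => exact ih.succ

theorem IsJSwitch.mono (h : IsJSwitch V m) (hmn : m ≤ n) : IsJSwitch V n := by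
  induction hmn with
  | refl => exact h
  | step _ ih => exact ih.succ

/-! ### Bounds for several levels at once -/

/-- The levels of `V` which are determined by failures of congruence modularity. -/
theorem le_of_not_isReversedModular (h : ¬ IsReversedModular V (2 * n - 1)) (hn : 1 ≤ n) :
    (∀ m, IsModular V m → 2 * n - 1 ≤ m) ∧ (∀ m, IsReversedModular V m → 2 * n ≤ m) ∧
    (∀ m, IsDirectedDistributive V m → n ≤ m) ∧ (∀ m, IsMixed V m → n ≤ m) ∧
    (∀ m, IsTwoHeadedDirectedGumm V m → n + 2 ≤ m) ∧
    (∀ m, IsDirectedAlvinHeads V m → n + 2 ≤ m) := by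
  have hr : ∀ m, IsReversedModular V m → 2 * n ≤ m := by
    intro m hm
    by_contra hc
    exact h (hm.mono (by omega))
  have hmod : ∀ m, IsModular V m → 2 * n - 1 ≤ m := fun m hm => by
    have := hr _ hm.isReversedModular
    omega
  have hmix : ∀ m, IsMixed V m → n ≤ m := fun m hm => by
    have := hmod _ hm.isModular
    omega
  have htwo : ∀ m, IsTwoHeadedDirectedGumm V m → n + 2 ≤ m := fun m hm => by
    have := hr _ hm.isReversedModular
    omega
  exact ⟨hmod, hr, fun m hm => hmix m hm.isMixed, hmix, htwo,
    fun m hm => htwo m hm.isTwoHeadedDirectedGumm⟩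

/-- All other conditions lead back to modularity: m-reversed-modular gives m + 1, m-mixed gives 2m -
1, and two-headed m-directed gives 2m - 2 by way of reversed modularity. -/
theorem le_of_not_isModular (h : ¬ IsModular V (2 * n - 3)) (hn : 2 ≤ n) :
    (∀ m, IsModular V m → 2 * n - 2 ≤ m) ∧ (∀ m, IsReversedModular V m → 2 * n - 3 ≤ m) ∧
    (∀ m, IsDirectedDistributive V m → n ≤ m) ∧ (∀ m, IsMixed V m → n ≤ m) ∧
    (∀ m, IsTwoHeadedDirectedGumm V m → n ≤ m) ∧ (∀ m, IsDirectedAlvinHeads V m → n ≤ m) := by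
  have hmod : ∀ m, IsModular V m → 2 * n - 2 ≤ m := by
    intro m hm
    by_contra hc
    exact h (hm.mono (by omega))
  have hr : ∀ m, IsReversedModular V m → 2 * n - 3 ≤ m := fun m hm => by
    have := hmod _ hm.isModular
    omega
  have hmix : ∀ m, IsMixed V m → n ≤ m := fun m hm => by
    have := hmod _ hm.isModular
    omega
  have htwo : ∀ m, IsTwoHeadedDirectedGumm V m → n ≤ m := fun m hm => by
    have := hr _ hm.isReversedModular
    omega
  exact ⟨hmod, hr, fun m hm => hmix m hm.isMixed, hmix, htwo,
    fun m hm => htwo m hm.isTwoHeadedDirectedGumm⟩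

theorem le_of_not_isSwitch (h : ¬ IsSwitch V n) :
    (∀ m, IsSwitch V m → n + 1 ≤ m) ∧ (∀ m, IsAlvin V m → n + 1 ≤ m) ∧
    (∀ m, IsGumm V m → n + 1 ≤ m) := by
  have hs : ∀ m, IsSwitch V m → n + 1 ≤ m := by
    intro m hm
    by_contra hc
    exact h (hm.mono (by omega))
  exact ⟨hs, fun m hm => hs m hm.isGumm.isSwitch, fun m hm => hs m hm.isSwitch⟩

theorem le_of_not_isJSwitch (h : ¬ IsJSwitch V n) (hn : 1 ≤ n) :
    (∀ m, IsDistributive V m → n + 1 ≤ m) ∧ (∀ m, IsJSwitch V m → n + 1 ≤ m) := by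
  have hs : ∀ m, IsJSwitch V m → n + 1 ≤ m := by
    intro m hm
    by_contra hc
    exact h (hm.mono (by omega))
  refine ⟨fun m hm => ?_, hs⟩
  rcases Nat.eq_zero_or_pos m with rfl | h0
  -- `IsJSwitch` excludes the index 0, so a 0-distributive variety is treated as 1-distributive.
  · exact absurd ((hm.mono (Nat.zero_le 1)).isJSwitch le_rfl |>.mono hn) h
  · exact hs m (hm.isJSwitch h0)

theorem not_isJSwitch_of_not_isSwitch (h : ¬ IsSwitch V (n + 1)) : ¬ IsJSwitch V n :=
  fun h' => h h'.isSwitch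

theorem not_isSwitch_of_not_isJSwitch (h : ¬ IsJSwitch V (n + 1)) : ¬ IsSwitch V n :=
  fun h' => h h'.isJSwitch

end Generic

section Variety

variable {L : FirstOrder.Language.{0, 0}} {K : AlgClass L} {m n : ℕ}

/-! ### Identities in the variety generated by a class -/

theorem subset_variety : K ⊆ variety K := fun _ hA _ _ h => h _ hA

/-- `variety` is defined by identities between terms in countably many variables. Relabelling with
possibly repeated indices covers patterns such as (x,x,z). -/
theorem variety_ev3 {s t : L.Term (Fin 3)} (i j k i' j' k' : ℕ)
    (h : ∀ B ∈ K, ∀ v : ℕ → B, ev3 s (v i) (v j) (v k) = ev3 t (v i') (v j') (v k'))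
    {A : Bundled.{0} L.Structure} (hA : A ∈ variety K) (v : ℕ → A) :
    ev3 s (v i) (v j) (v k) = ev3 t (v i') (v j') (v k') := by
  have hc : ∀ {B : Bundled.{0} L.Structure} (t : L.Term (Fin 3)) (v : ℕ → B) (i j k : ℕ),
      (t.relabel ![i, j, k]).realize v = ev3 t (v i) (v j) (v k) := by
    intro B t v i j k
    rw [Term.realize_relabel]
    unfold ev3
    congr 1
    funext l
    fin_cases l <;> rfl
  rw [← hc, ← hc]
  refine hA _ _ (fun B hB w => ?_) v
  rw [hc, hc, h B hB]

theorem variety_ev4 {s t : L.Term (Fin 4)} (i j k l i' j' k' l' : ℕ)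
    (h : ∀ B ∈ K, ∀ v : ℕ → B,
      ev4 s (v i) (v j) (v k) (v l) = ev4 t (v i') (v j') (v k') (v l'))
    {A : Bundled.{0} L.Structure} (hA : A ∈ variety K) (v : ℕ → A) :
    ev4 s (v i) (v j) (v k) (v l) = ev4 t (v i') (v j') (v k') (v l') := by
  have hc : ∀ {B : Bundled.{0} L.Structure} (t : L.Term (Fin 4)) (v : ℕ → B) (i j k l : ℕ),
      (t.relabel ![i, j, k, l]).realize v = ev4 t (v i) (v j) (v k) (v l) := by
    intro B t v i j k l
    rw [Term.realize_relabel]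
    unfold ev4
    congr 1
    funext l
    fin_cases l <;> rfl
  rw [← hc, ← hc]
  refine hA _ _ (fun B hB w => ?_) v
  rw [hc, hc, h B hB]

/-- The sequence starting with `x, y, z` and continuing with `w, w, …`. -/
def seq4 {A : Type} (x y z w : A) : ℕ → A
  | 0 => x
  | 1 => y
  | 2 => z
  | _ => w

theorem EqLeft.variety {s t : L.Term (Fin 3)} (h : EqLeft K s t) : EqLeft (variety K) s t :=
  fun _ hA x z => variety_ev3 0 0 1 0 0 1 (fun B hB _ => h B hB _ _) hA (seq4 x z z z)

theorem EqRight.variety {s t : L.Term (Fin 3)} (h : EqRight K s t) : EqRight (variety K) s t :=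
  fun _ hA x z => variety_ev3 0 1 1 0 1 1 (fun B hB _ => h B hB _ _) hA (seq4 x z z z)

theorem EqForward.variety {s t : L.Term (Fin 3)} (h : EqForward K s t) :
    EqForward (variety K) s t :=
  fun _ hA x z => variety_ev3 0 1 1 0 0 1 (fun B hB _ => h B hB _ _) hA (seq4 x z z z)

theorem Absorbs.variety {t : L.Term (Fin 3)} (h : Absorbs K t) : Absorbs (variety K) t :=
  fun _ hA x y => variety_ev3 (t := tv 0) 0 1 0 0 1 0 (fun B hB _ => h B hB _ _) hA (seq4 x y y y)

theorem Ends.variety {t : ℕ → L.Term (Fin 3)} (h : Ends K n t) : Ends (variety K) n t :=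
  fun _ hA x y z =>
    ⟨variety_ev3 (t := tv 0) 0 1 2 0 1 2 (fun B hB _ => (h B hB _ _ _).1) hA (seq4 x y z z),
      variety_ev3 (t := tv 2) 0 1 2 0 1 2 (fun B hB _ => (h B hB _ _ _).2) hA (seq4 x y z z)⟩

theorem IsDistributive.variety (h : IsDistributive K n) : IsDistributive (variety K) n := by
  obtain ⟨t, hE, hA, hS⟩ := h
  exact ⟨t, hE.variety, fun k hk => (hA k hk).variety,
    fun k hk => ⟨fun he => ((hS k hk).1 he).variety, fun ho => ((hS k hk).2 ho).variety⟩⟩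

theorem IsAlvin.variety (h : IsAlvin K n) : IsAlvin (variety K) n := by
  obtain ⟨t, hE, hA, hS⟩ := h
  exact ⟨t, hE.variety, fun k hk => (hA k hk).variety,
    fun k hk => ⟨fun he => ((hS k hk).1 he).variety, fun ho => ((hS k hk).2 ho).variety⟩⟩

theorem IsDirectedDistributive.variety (h : IsDirectedDistributive K n) :
    IsDirectedDistributive (variety K) n := by
  obtain ⟨t, hE, hA, hS⟩ := h
  exact ⟨t, hE.variety, fun k hk => (hA k hk).variety, fun k hk => (hS k hk).variety⟩

theorem IsDirectedAlvinHeads.variety (h : IsDirectedAlvinHeads K n) :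
    IsDirectedAlvinHeads (variety K) n := by
  obtain ⟨hn, p, t, q, ⟨hA, hp, hp2, hF, hq2, hq⟩, hpA, hqA⟩ := h
  refine ⟨hn, p, t, q, ⟨fun h h2 hh => (hA h h2 hh).variety, ?_, hp2.variety,
    fun h h2 hh => (hF h h2 hh).variety, hq2.variety, ?_⟩, hpA.variety, hqA.variety⟩
  · exact EqRight.variety (t := tv 0) hp
  · exact EqLeft.variety (t := tv 2) hq

theorem IsModular.variety (h : IsModular K m) : IsModular (variety K) m := by
  obtain ⟨u, hB, hS⟩ := h
  refine ⟨u, ⟨fun A hA x y z w => ⟨?_, ?_⟩, fun k hk A hA x y => ?_⟩, fun k hk => ⟨?_, ?_⟩⟩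
  · exact variety_ev4 (t := tv 0) 0 1 2 3 0 1 2 3 (fun B hV _ => (hB.1 B hV _ _ _ _).1) hA
      (seq4 x y z w)
  · exact variety_ev4 (t := tv 3) 0 1 2 3 0 1 2 3 (fun B hV _ => (hB.1 B hV _ _ _ _).2) hA
      (seq4 x y z w)
  · exact variety_ev4 (t := tv 0) 0 1 1 0 0 1 1 0 (fun B hV _ => hB.2 k hk B hV _ _) hA
      (seq4 x y y y)
  · exact fun he A hA x w => variety_ev4 0 0 1 1 0 0 1 1 (fun B hV _ => (hS k hk).1 he B hV _ _) hA
      (seq4 x w w w)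
  · exact fun ho A hA x y w => variety_ev4 0 1 1 2 0 1 1 2
      (fun B hV _ => (hS k hk).2 ho B hV _ _ _) hA (seq4 x y w w)

theorem IsModular.of_variety (h : IsModular (CongLevels.variety K) m) : IsModular K m := by
  obtain ⟨u, hB, hS⟩ := h
  exact ⟨u, ⟨fun A hA => hB.1 A (subset_variety hA), fun k hk A hA => hB.2 k hk A (subset_variety hA)⟩,
    fun k hk => ⟨fun he A hA => (hS k hk).1 he A (subset_variety hA),
      fun ho A hA => (hS k hk).2 ho A (subset_variety hA)⟩⟩

theorem IsReversedModular.of_variety (h : IsReversedModular (CongLevels.variety K) m) :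
    IsReversedModular K m := by
  obtain ⟨u, hB, hS⟩ := h
  exact ⟨u, ⟨fun A hA => hB.1 A (subset_variety hA), fun k hk A hA => hB.2 k hk A (subset_variety hA)⟩,
    fun k hk => ⟨fun he A hA => (hS k hk).1 he A (subset_variety hA),
      fun ho A hA => (hS k hk).2 ho A (subset_variety hA)⟩⟩

/-- The algebra with one element. -/
def unitAlg (L : FirstOrder.Language.{0, 0}) : Bundled.{0} L.Structure where
  α := Unit
  str := { funMap := fun _ _ => (), RelMap := fun _ _ => False }

theorem unitAlg_mem_variety : unitAlg L ∈ variety K := fun _ _ _ _ => Subsingleton.elim (α := Unit) _ _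

end Variety

/-! ### Algebras of ternary term functions -/

section TermFunctions

variable {L : FirstOrder.Language.{0, 0}} {ι : Type} (G : ι → Bundled.{0} L.Structure)

/-- The algebra of all ternary term functions on a family of algebras. -/
def termFunAlg : Bundled.{0} L.Structure where
  α := {f : ∀ p : (Σ i, Fin 3 → G i), G p.1 // ∃ t : L.Term (Fin 3), ∀ p, f p = t.realize p.2}
  str :=
    { funMap := fun F v => ⟨fun p => FirstOrder.Language.Structure.funMap F fun j => (v j).1 p, by
        choose t ht using fun j => (v j).2
        refine ⟨.func F t, fun p => ?_⟩
        exact congrArg (FirstOrder.Language.Structure.funMap F) (funext fun j => ht j p)⟩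
      RelMap := fun _ _ => False }

/-- The value of a term function. -/
def termVal {G : ι → Bundled.{0} L.Structure} (f : termFunAlg G) (p : Σ i, Fin 3 → G i) :
    G p.1 :=
  f.1 p

theorem termFunAlg.ext {G : ι → Bundled.{0} L.Structure} {f g : termFunAlg G}
    (h : ∀ p, termVal f p = termVal g p) : f = g :=
  Subtype.ext (funext h)

theorem termVal_realize {G : ι → Bundled.{0} L.Structure} {κ : Type} (t : L.Term κ)
    (v : κ → termFunAlg G) (p : Σ i, Fin 3 → G i) :
    termVal (t.realize v) p = t.realize fun j => termVal (v j) p := by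
  induction t with
  | var j => rfl
  | func F ts ih =>
    rw [Term.realize_func, Term.realize_func, ← funext ih]
    rfl

/-- Up to isomorphism, this is the free algebra on three generators in the variety generated by `G`,
where congruence identities become statements about terms. -/
theorem termFunAlg_mem_variety : termFunAlg G ∈ variety (Set.range G) := by
  intro s t h v
  refine termFunAlg.ext fun p => ?_
  rw [termVal_realize, termVal_realize]
  exact h _ ⟨p.1, rfl⟩ _

/-- The congruence relating term functions which agree at all points with property `S`. -/
def agreeCong (S : (Σ i, Fin 3 → G i) → Prop) : Congruence (termFunAlg G) where
  r f g := ∀ p, S p → termVal f p = termVal g p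
  iseqv := ⟨fun _ _ _ => rfl, fun h p hp => (h p hp).symm, fun h h' p hp => (h p hp).trans (h' p hp)⟩
  compat F v w h p hp := by
    change FirstOrder.Language.Structure.funMap F (fun j => termVal (v j) p) =
      FirstOrder.Language.Structure.funMap F (fun j => termVal (w j) p)
    congr 1
    funext j
    exact h j p hp

/-- The term function given by a term. -/
def termFun (t : L.Term (Fin 3)) : termFunAlg G := ⟨fun p => t.realize p.2, t, fun _ => rfl⟩

variable {G}

theorem exists_eq_termFun (f : termFunAlg G) : ∃ t, f = termFun G t := by
  obtain ⟨t, ht⟩ := f.2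
  exact ⟨t, Subtype.ext (funext ht)⟩

theorem mem_agreeCong {S : (Σ i, Fin 3 → G i) → Prop} {s t : L.Term (Fin 3)} :
    (termFun G s, termFun G t) ∈ (agreeCong G S).rel ↔ ∀ p, S p → s.realize p.2 = t.realize p.2 :=
  Iff.rfl

theorem mem_agreeCong_left {s t : L.Term (Fin 3)} :
    (termFun G s, termFun G t) ∈ (agreeCong G fun p => p.2 0 = p.2 1).rel ↔
      EqLeft (Set.range G) s t := by
  rw [mem_agreeCong]
  constructor
  · rintro h _ ⟨i, rfl⟩ x z
    exact h ⟨i, ![x, x, z]⟩ rfl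
  · rintro h ⟨i, v⟩ hv
    have : v = ![v 0, v 0, v 2] := by
      funext j
      fin_cases j
      exacts [rfl, hv.symm, rfl]
    change s.realize v = t.realize v
    rw [this]
    exact h _ ⟨i, rfl⟩ _ _

theorem mem_agreeCong_right {s t : L.Term (Fin 3)} :
    (termFun G s, termFun G t) ∈ (agreeCong G fun p => p.2 1 = p.2 2).rel ↔
      EqRight (Set.range G) s t := by
  rw [mem_agreeCong]
  constructor
  · rintro h _ ⟨i, rfl⟩ x z
    exact h ⟨i, ![x, z, z]⟩ rfl
  · rintro h ⟨i, v⟩ hv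
    have : v = ![v 0, v 2, v 2] := by
      funext j
      fin_cases j
      exacts [rfl, hv, rfl]
    change s.realize v = t.realize v
    rw [this]
    exact h _ ⟨i, rfl⟩ _ _

theorem mem_agreeCong_outer {t : L.Term (Fin 3)} :
    (termFun G (tv 0), termFun G t) ∈ (agreeCong G fun p => p.2 0 = p.2 2).rel ↔
      Absorbs (Set.range G) t := by
  rw [mem_agreeCong]
  constructor
  · rintro h _ ⟨i, rfl⟩ x y
    exact (h ⟨i, ![x, y, x]⟩ rfl).symm
  · rintro h ⟨i, v⟩ hv
    have : v = ![v 0, v 1, v 0] := by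
      funext j
      fin_cases j
      exacts [rfl, rfl, hv.symm]
    change v 0 = t.realize v
    rw [this]
    exact (h _ ⟨i, rfl⟩ _ _).symm

/-- The links in a chain of terms witnessing a power of `α(γ ∘ β)`. -/
def SwitchChain (K : AlgClass L) (l : ℕ) (s r : ℕ → L.Term (Fin 3)) : Prop :=
  (∀ h ≤ l, Absorbs K (s h)) ∧ ∀ h < l, EqRight K (s h) (r h) ∧ EqLeft K (r h) (s (h + 1))

/-- The term condition for the switch level to be at most `2 * l`. -/
def HasSwitchTerms (K : AlgClass L) (l : ℕ) : Prop :=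
  ∃ s r : ℕ → L.Term (Fin 3), Ends K l s ∧ SwitchChain K l s r

/-- The term condition for the J-switch level to be at most `2 * l + 2`. -/
def HasJSwitchTerms (K : AlgClass L) (l : ℕ) : Prop :=
  ∃ s r : ℕ → L.Term (Fin 3), EqLeft K (tv 0) (s 0) ∧ EqRight K (s l) (tv 2) ∧ SwitchChain K l s r

/-- This is the usual Mal'cev argument: intermediate elements of the free algebra are terms, and
each of the three congruences, agreement where x = z, x = y or y = z, expresses one kind of
identity. -/
theorem exists_switchChain {a b : termFunAlg G} {l : ℕ}
    (ha : (termFun G (tv 0), a) ∈ (agreeCong G fun p => p.2 0 = p.2 2).rel)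
    (h : (a, b) ∈ relPow ((agreeCong G fun p => p.2 0 = p.2 2).rel ∩
      ((agreeCong G fun p => p.2 1 = p.2 2).rel ○ (agreeCong G fun p => p.2 0 = p.2 1).rel)) l) :
    ∃ s r : ℕ → L.Term (Fin 3), termFun G (s 0) = a ∧ termFun G (s l) = b ∧
      SwitchChain (Set.range G) l s r := by
  obtain ⟨f, h0, hl, hf⟩ := exists_seq_of_mem_relPow h
  have hg : ∀ j, ∃ g, j < l → (f j, g) ∈ (agreeCong G fun p => p.2 1 = p.2 2).rel ∧
      (g, f (j + 1)) ∈ (agreeCong G fun p => p.2 0 = p.2 1).rel := by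
    intro j
    by_cases hj : j < l
    · obtain ⟨-, g, hg⟩ := hf j hj
      exact ⟨g, fun _ => hg⟩
    · exact ⟨f j, fun h => absurd h hj⟩
  choose g hg using hg
  choose s hs using fun j => exists_eq_termFun (f j)
  choose r hr using fun j => exists_eq_termFun (g j)
  refine ⟨s, r, by rw [← hs, h0], by rw [← hs, hl], fun k hk => ?_, fun k hk => ?_⟩
  · rw [← mem_agreeCong_outer, ← hs]
    induction k with
    | zero => rwa [h0]
    | succ k ih => exact Congruence.trans' _ (ih (by omega)) (hf k hk).1
  · rw [← mem_agreeCong_right, ← mem_agreeCong_left, ← hs, ← hr, ← hs]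
    exact hg k hk

theorem termFun_vars_mem :
    (termFun G (tv 0), termFun G (tv 2)) ∈ (agreeCong G fun p => p.2 0 = p.2 2).rel ∩
      ((agreeCong G fun p => p.2 0 = p.2 1).rel ○ (agreeCong G fun p => p.2 1 = p.2 2).rel) :=
  ⟨fun _ hp => hp, termFun G (tv 1), fun _ hp => hp, fun _ hp => hp⟩

theorem ev3_of_termFun_eq {s t : L.Term (Fin 3)} (h : termFun G s = termFun G t) (i : ι)
    (x y z : G i) : ev3 s x y z = ev3 t x y z :=
  congrArg (fun f => termVal f ⟨i, ![x, y, z]⟩) h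

theorem IsSwitch.hasSwitchTerms {l : ℕ} (h : IsSwitch (variety (Set.range G)) (2 * l)) :
    HasSwitchTerms (Set.range G) l := by
  -- The three congruences are determined by unification with `termFun_vars_mem`.
  have := (h _ (termFunAlg_mem_variety G) _ _ _).1 (by simp) termFun_vars_mem
  rw [show 2 * l / 2 = l by omega] at this
  obtain ⟨s, r, h0, hl, hc⟩ := exists_switchChain (Congruence.refl' _ _) this
  refine ⟨s, r, ?_, hc⟩
  rintro _ ⟨i, rfl⟩ x y z
  exact ⟨ev3_of_termFun_eq h0 i x y z, ev3_of_termFun_eq hl i x y z⟩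

theorem IsJSwitch.hasJSwitchTerms {l : ℕ} (h : IsJSwitch (variety (Set.range G)) (2 * l + 2)) :
    HasJSwitchTerms (Set.range G) l := by
  obtain ⟨b, ⟨a, h1, h2⟩, h3⟩ :=
    (h.2 _ (termFunAlg_mem_variety G) _ _ _).1 (by simp [parity_simps]) termFun_vars_mem
  rw [show (2 * l + 2) / 2 - 1 = l by omega] at h2
  obtain ⟨s, r, h0, hl, hc⟩ := exists_switchChain h1.1 h2
  refine ⟨s, r, ?_, ?_, hc⟩
  · rw [← mem_agreeCong_left, h0]
    exact h1.2
  · rw [← mem_agreeCong_right, hl]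
    exact h3.2

end TermFunctions

/-! ### Interpretations and non-indexed products -/

section Interpretation

variable {L M : FirstOrder.Language.{0, 0}} {U : AlgClass M} {V : AlgClass L} {m : ℕ}

/-- The clone of `U` maps to the clone of `V`: terms for `U` translate to terms for `V`, and every
algebra in `V` is, with the translated terms, a homomorphic image of an algebra in `U`. -/
def Interpretable (U : AlgClass M) (V : AlgClass L) : Prop :=
  ∃ tr : ∀ k, M.Term (Fin k) → L.Term (Fin k), ∀ A ∈ V, ∃ C ∈ U, ∃ φ : C → A,
    Function.Surjective φ ∧ ∀ k (t : M.Term (Fin k)) (v : Fin k → C),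
      φ (t.realize v) = (tr k t).realize (φ ∘ v)

theorem map_ev4 {A : Bundled.{0} L.Structure} {C : Bundled.{0} M.Structure} {φ : C → A}
    {t : M.Term (Fin 4)} {t' : L.Term (Fin 4)}
    (h : ∀ v : Fin 4 → C, φ (t.realize v) = t'.realize (φ ∘ v)) (x y z w : C) :
    φ (ev4 t x y z w) = ev4 t' (φ x) (φ y) (φ z) (φ w) := by
  unfold ev4
  rw [h]
  congr 1
  funext i
  fin_cases i <;> rfl

theorem map_ev3 {A : Bundled.{0} L.Structure} {C : Bundled.{0} M.Structure} {φ : C → A}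
    {t : M.Term (Fin 3)} {t' : L.Term (Fin 3)}
    (h : ∀ v : Fin 3 → C, φ (t.realize v) = t'.realize (φ ∘ v)) (x y z : C) :
    φ (ev3 t x y z) = ev3 t' (φ x) (φ y) (φ z) := by
  unfold ev3
  rw [h]
  congr 1
  funext i
  fin_cases i <;> rfl

theorem Interpretable.exists_forall_ev4 (h : Interpretable U V) :
    ∃ tr : M.Term (Fin 4) → L.Term (Fin 4), ∀ A ∈ V, ∃ C ∈ U, ∃ φ : C → A,
      Function.Surjective φ ∧ ∀ (t : M.Term (Fin 4)) (x y z w : C),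
        φ (ev4 t x y z w) = ev4 (tr t) (φ x) (φ y) (φ z) (φ w) := by
  obtain ⟨tr, htr⟩ := h
  refine ⟨tr 4, fun A hA => ?_⟩
  obtain ⟨C, hC, φ, hφ, hr⟩ := htr A hA
  exact ⟨C, hC, φ, hφ, fun t => map_ev4 (hr 4 t)⟩

theorem Interpretable.dayBasic {tr : M.Term (Fin 4) → L.Term (Fin 4)}
    (htr : ∀ A ∈ V, ∃ C ∈ U, ∃ φ : C → A,
      Function.Surjective φ ∧ ∀ (t : M.Term (Fin 4)) (x y z w : C),
        φ (ev4 t x y z w) = ev4 (tr t) (φ x) (φ y) (φ z) (φ w)) {u : ℕ → M.Term (Fin 4)}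
    (hu : DayBasic U m u) : DayBasic V m fun k => tr (u k) := by
  refine ⟨fun A hA x y z w => ?_, fun k hk A hA x y => ?_⟩ <;>
    obtain ⟨C, hC, φ, hφ, hr⟩ := htr A hA <;> obtain ⟨x, rfl⟩ := hφ x <;> obtain ⟨y, rfl⟩ := hφ y
  · obtain ⟨z, rfl⟩ := hφ z
    obtain ⟨w, rfl⟩ := hφ w
    rw [← hr, ← hr, (hu.1 C hC x y z w).1, (hu.1 C hC x y z w).2]
    exact ⟨rfl, rfl⟩
  · rw [← hr, hu.2 k hk C hC]

theorem Interpretable.dayOuter {tr : M.Term (Fin 4) → L.Term (Fin 4)}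
    (htr : ∀ A ∈ V, ∃ C ∈ U, ∃ φ : C → A,
      Function.Surjective φ ∧ ∀ (t : M.Term (Fin 4)) (x y z w : C),
        φ (ev4 t x y z w) = ev4 (tr t) (φ x) (φ y) (φ z) (φ w)) {s t : M.Term (Fin 4)}
    (h : DayOuter U s t) : DayOuter V (tr s) (tr t) := by
  intro A hA x w
  obtain ⟨C, hC, φ, hφ, hr⟩ := htr A hA
  obtain ⟨x, rfl⟩ := hφ x
  obtain ⟨w, rfl⟩ := hφ w
  rw [← hr, ← hr, h C hC]

theorem Interpretable.dayInner {tr : M.Term (Fin 4) → L.Term (Fin 4)}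
    (htr : ∀ A ∈ V, ∃ C ∈ U, ∃ φ : C → A,
      Function.Surjective φ ∧ ∀ (t : M.Term (Fin 4)) (x y z w : C),
        φ (ev4 t x y z w) = ev4 (tr t) (φ x) (φ y) (φ z) (φ w)) {s t : M.Term (Fin 4)}
    (h : DayInner U s t) : DayInner V (tr s) (tr t) := by
  intro A hA x y w
  obtain ⟨C, hC, φ, hφ, hr⟩ := htr A hA
  obtain ⟨x, rfl⟩ := hφ x
  obtain ⟨y, rfl⟩ := hφ y
  obtain ⟨w, rfl⟩ := hφ w
  rw [← hr, ← hr, h C hC]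

theorem Interpretable.isModular (h : Interpretable U V) (hU : IsModular U m) : IsModular V m := by
  obtain ⟨tr, htr⟩ := h.exists_forall_ev4
  obtain ⟨u, hB, hS⟩ := hU
  exact ⟨_, dayBasic htr hB, fun k hk => ⟨fun he => dayOuter htr ((hS k hk).1 he),
    fun ho => dayInner htr ((hS k hk).2 ho)⟩⟩

theorem Interpretable.isReversedModular (h : Interpretable U V) (hU : IsReversedModular U m) :
    IsReversedModular V m := by
  obtain ⟨tr, htr⟩ := h.exists_forall_ev4
  obtain ⟨u, hB, hS⟩ := hU
  exact ⟨_, dayBasic htr hB, fun k hk => ⟨fun he => dayInner htr ((hS k hk).1 he),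
    fun ho => dayOuter htr ((hS k hk).2 ho)⟩⟩

/-- The inverse image of a congruence under a map which respects term operations. -/
def Congruence.pullback {A : Bundled.{0} L.Structure} {C : Bundled.{0} M.Structure} {φ : C → A}
    {tr : ∀ k, M.Term (Fin k) → L.Term (Fin k)}
    (h : ∀ k (t : M.Term (Fin k)) (v : Fin k → C), φ (t.realize v) = (tr k t).realize (φ ∘ v))
    (α : Congruence A) : Congruence C where
  toSetoid := α.toSetoid.comap φ
  compat {k} f v w hvw := by
    have := α.realize (tr k f.term) (v := φ ∘ v) (w := φ ∘ w) hvw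
    rwa [← h, ← h, Term.realize_function_term, Term.realize_function_term] at this

theorem mem_relPow_map {A C : Type} {φ : C → A} {R : SetRel C C} {S : SetRel A A}
    (h : ∀ a b, (a, b) ∈ R → (φ a, φ b) ∈ S) {k : ℕ} {a b : C} (hab : (a, b) ∈ relPow R k) :
    (φ a, φ b) ∈ relPow S k := by
  induction k generalizing b with
  | zero => exact congrArg φ hab
  | succ k ih =>
    obtain ⟨c, hc, hcb⟩ := hab
    exact ⟨φ c, ih hc, h _ _ hcb⟩

/-- Congruences are pulled back along the surjection, the inclusion is applied upstairs, and the
resulting chain is mapped down again. -/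
theorem Interpretable.isSwitch (h : Interpretable U V) (hU : IsSwitch U m) : IsSwitch V m := by
  obtain ⟨tr, htr⟩ := h
  intro A hA α β γ
  obtain ⟨C, hC, φ, hφ, hr⟩ := htr A hA
  have hs := hU C hC (α.pullback hr) (β.pullback hr) (γ.pullback hr)
  have hstep : ∀ a b, (a, b) ∈ (α.pullback hr).rel ∩ ((γ.pullback hr).rel ○ (β.pullback hr).rel) →
      (φ a, φ b) ∈ α.rel ∩ (γ.rel ○ β.rel) := fun a b ⟨h1, c, h2, h3⟩ => ⟨h1, φ c, h2, h3⟩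
  refine ⟨fun he => ?_, fun ho => ?_⟩ <;> rintro ⟨a, c⟩ ⟨hac, b, hab, hbc⟩ <;>
    obtain ⟨a, rfl⟩ := hφ a <;> obtain ⟨b, rfl⟩ := hφ b <;> obtain ⟨c, rfl⟩ := hφ c
  · have h1 : (a, c) ∈ _ := hs.1 he ⟨hac, b, hab, hbc⟩
    exact mem_relPow_map hstep h1
  · have h1 : (a, c) ∈ _ := hs.2 ho ⟨hac, b, hab, hbc⟩
    obtain ⟨d, h1, h2⟩ := h1
    exact ⟨φ d, mem_relPow_map hstep h1, h2⟩

theorem Interpretable.isJSwitch (h : Interpretable U V) (hU : IsJSwitch U m) : IsJSwitch V m := by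
  obtain ⟨tr, htr⟩ := h
  refine ⟨hU.1, ?_⟩
  intro A hA α β γ
  obtain ⟨C, hC, φ, hφ, hr⟩ := htr A hA
  have hs := hU.2 C hC (α.pullback hr) (β.pullback hr) (γ.pullback hr)
  have hstep : ∀ a b, (a, b) ∈ (α.pullback hr).rel ∩ ((γ.pullback hr).rel ○ (β.pullback hr).rel) →
      (φ a, φ b) ∈ α.rel ∩ (γ.rel ○ β.rel) := fun a b ⟨h1, c, h2, h3⟩ => ⟨h1, φ c, h2, h3⟩
  refine ⟨fun he => ?_, fun ho => ?_⟩ <;> rintro ⟨a, c⟩ ⟨hac, b, hab, hbc⟩ <;>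
    obtain ⟨a, rfl⟩ := hφ a <;> obtain ⟨b, rfl⟩ := hφ b <;> obtain ⟨c, rfl⟩ := hφ c
  · have h1 : (a, c) ∈ _ := hs.1 he ⟨hac, b, hab, hbc⟩
    obtain ⟨d, ⟨e, h1, h2⟩, h3⟩ := h1
    exact ⟨φ d, ⟨φ e, h1, mem_relPow_map hstep h2⟩, h3⟩
  · have h1 : (a, c) ∈ _ := hs.2 ho ⟨hac, b, hab, hbc⟩
    obtain ⟨d, h1, h2⟩ := h1
    exact ⟨φ d, h1, mem_relPow_map hstep h2⟩

end Interpretation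

/-! ### Conditions in non-indexed products -/

section Product

variable {L M : FirstOrder.Language.{0, 0}} {V : AlgClass L} {W : AlgClass M} {m n : ℕ}

/-- The first component of a term in the signature of a non-indexed product. -/
def fstTerm {κ : Type} : (prodSig L M).Term κ → L.Term κ
  | .var a => .var a
  | .func f ts => Term.subst (Prod.fst f) fun i => fstTerm (ts i)

/-- The second component of a term in the signature of a non-indexed product. -/
def sndTerm {κ : Type} : (prodSig L M).Term κ → M.Term κ
  | .var a => .var a
  | .func f ts => Term.subst (Prod.snd f) fun i => sndTerm (ts i)

/-- The first projection of a non-indexed product. -/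
def algFst {A : Bundled.{0} L.Structure} {B : Bundled.{0} M.Structure} (c : algProd A B) : A :=
  Prod.fst c

/-- The second projection of a non-indexed product. -/
def algSnd {A : Bundled.{0} L.Structure} {B : Bundled.{0} M.Structure} (c : algProd A B) : B :=
  Prod.snd c

theorem fst_realize {A : Bundled.{0} L.Structure} {B : Bundled.{0} M.Structure} {κ : Type}
    (t : (prodSig L M).Term κ) (v : κ → algProd A B) :
    algFst (t.realize v) = (fstTerm t).realize fun i => algFst (v i) := by
  induction t with
  | var => rfl
  | func f ts ih =>
    rw [Term.realize_func, fstTerm, Term.realize_subst, ← funext ih]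
    rfl

theorem snd_realize {A : Bundled.{0} L.Structure} {B : Bundled.{0} M.Structure} {κ : Type}
    (t : (prodSig L M).Term κ) (v : κ → algProd A B) :
    algSnd (t.realize v) = (sndTerm t).realize fun i => algSnd (v i) := by
  induction t with
  | var => rfl
  | func f ts ih =>
    rw [Term.realize_func, sndTerm, Term.realize_subst, ← funext ih]
    rfl

theorem algProd_mem {A : Bundled.{0} L.Structure} {B : Bundled.{0} M.Structure} (hA : A ∈ V)
    (hB : B ∈ W) : algProd A B ∈ varProd V W :=
  ⟨A, hA, B, hB, ⟨FirstOrder.Language.Equiv.refl _ _⟩⟩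

/-- An element `b` makes the first projection surjective; the one-element algebra will supply it. -/
theorem interpretable_fst {B : Bundled.{0} M.Structure} (hB : B ∈ W) (b : B) :
    Interpretable (varProd V W) V :=
  ⟨fun _ => fstTerm, fun A hA => ⟨algProd A B, algProd_mem hA hB, algFst,
    fun a => ⟨(a, b), rfl⟩, fun _ t v => fst_realize t v⟩⟩

theorem interpretable_snd {A : Bundled.{0} L.Structure} (hA : A ∈ V) (a : A) :
    Interpretable (varProd V W) W :=
  ⟨fun _ => sndTerm, fun B hB => ⟨algProd A B, algProd_mem hA hB, algSnd,
    fun b => ⟨(a, b), rfl⟩, fun _ t v => snd_realize t v⟩⟩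

/-- The operation symbol given by a pair of terms, as a term. -/
def pairTerm {k : ℕ} (s : L.Term (Fin k)) (t : M.Term (Fin k)) : (prodSig L M).Term (Fin k) :=
  .func (L := prodSig L M) (l := k) (s, t) Term.var

/-- The two maps are jointly injective, so an identity between pairs of terms can be checked in each
factor separately. This hides the isomorphism in the definition of `varProd`. -/
theorem exists_components {C : Bundled.{0} (prodSig L M).Structure} (hC : C ∈ varProd V W) :
    ∃ A ∈ V, ∃ B ∈ W, ∃ φ : C → A, ∃ ψ : C → B,
      (∀ c d, φ c = φ d → ψ c = ψ d → c = d) ∧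
      (∀ s t x y z, φ (ev3 (pairTerm s t) x y z) = ev3 s (φ x) (φ y) (φ z)) ∧
      (∀ s t x y z, ψ (ev3 (pairTerm s t) x y z) = ev3 t (ψ x) (ψ y) (ψ z)) ∧
      (∀ s t x y z w, φ (ev4 (pairTerm s t) x y z w) = ev4 s (φ x) (φ y) (φ z) (φ w)) ∧
      (∀ s t x y z w, ψ (ev4 (pairTerm s t) x y z w) = ev4 t (ψ x) (ψ y) (ψ z) (ψ w)) := by
  obtain ⟨A, hA, B, hB, ⟨e⟩⟩ := hC
  have h1 : ∀ (k : ℕ) (s : L.Term (Fin k)) (t : M.Term (Fin k)) (v : Fin k → C),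
      algFst (e ((pairTerm s t).realize v)) = s.realize ((fun c => algFst (e c)) ∘ v) := by
    intro k s t v
    rw [← FirstOrder.Language.HomClass.realize_term]
    rfl
  have h2 : ∀ (k : ℕ) (s : L.Term (Fin k)) (t : M.Term (Fin k)) (v : Fin k → C),
      algSnd (e ((pairTerm s t).realize v)) = t.realize ((fun c => algSnd (e c)) ∘ v) := by
    intro k s t v
    rw [← FirstOrder.Language.HomClass.realize_term]
    rfl
  refine ⟨A, hA, B, hB, fun c => algFst (e c), fun c => algSnd (e c), ?_,
    fun s t => map_ev3 (φ := fun c => algFst (e c)) (h1 3 s t),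
    fun s t => map_ev3 (φ := fun c => algSnd (e c)) (h2 3 s t),
    fun s t => map_ev4 (φ := fun c => algFst (e c)) (h1 4 s t),
    fun s t => map_ev4 (φ := fun c => algSnd (e c)) (h2 4 s t)⟩
  exact fun c d hc hd => e.injective (Prod.ext hc hd)

theorem EqLeft.pair {s t : L.Term (Fin 3)} {s' t' : M.Term (Fin 3)} (h : EqLeft V s t)
    (h' : EqLeft W s' t') : EqLeft (varProd V W) (pairTerm s s') (pairTerm t t') := by
  intro C hC x z
  obtain ⟨A, hA, B, hB, φ, ψ, hinj, h1, h2, -⟩ := exists_components hC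
  exact hinj _ _ (by rw [h1, h1, h A hA]) (by rw [h2, h2, h' B hB])

theorem EqRight.pair {s t : L.Term (Fin 3)} {s' t' : M.Term (Fin 3)} (h : EqRight V s t)
    (h' : EqRight W s' t') : EqRight (varProd V W) (pairTerm s s') (pairTerm t t') := by
  intro C hC x z
  obtain ⟨A, hA, B, hB, φ, ψ, hinj, h1, h2, -⟩ := exists_components hC
  exact hinj _ _ (by rw [h1, h1, h A hA]) (by rw [h2, h2, h' B hB])

theorem EqForward.pair {s t : L.Term (Fin 3)} {s' t' : M.Term (Fin 3)} (h : EqForward V s t)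
    (h' : EqForward W s' t') : EqForward (varProd V W) (pairTerm s s') (pairTerm t t') := by
  intro C hC x z
  obtain ⟨A, hA, B, hB, φ, ψ, hinj, h1, h2, -⟩ := exists_components hC
  exact hinj _ _ (by rw [h1, h1, h A hA]) (by rw [h2, h2, h' B hB])

theorem Absorbs.pair {s : L.Term (Fin 3)} {t : M.Term (Fin 3)} (h : Absorbs V s)
    (h' : Absorbs W t) : Absorbs (varProd V W) (pairTerm s t) := by
  intro C hC x y
  obtain ⟨A, hA, B, hB, φ, ψ, hinj, h1, h2, -⟩ := exists_components hC
  exact hinj _ _ (by rw [h1, h A hA]) (by rw [h2, h' B hB])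

theorem Ends.pair {s : ℕ → L.Term (Fin 3)} {t : ℕ → M.Term (Fin 3)} (h : Ends V n s)
    (h' : Ends W n t) : Ends (varProd V W) n fun k => pairTerm (s k) (t k) := by
  intro C hC x y z
  obtain ⟨A, hA, B, hB, φ, ψ, hinj, h1, h2, -⟩ := exists_components hC
  exact ⟨hinj _ _ (by rw [h1, (h A hA _ _ _).1]) (by rw [h2, (h' B hB _ _ _).1]),
    hinj _ _ (by rw [h1, (h A hA _ _ _).2]) (by rw [h2, (h' B hB _ _ _).2])⟩

theorem IsDistributive.prod (h : IsDistributive V n) (h' : IsDistributive W n) :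
    IsDistributive (varProd V W) n := by
  obtain ⟨s, hE, hA, hS⟩ := h
  obtain ⟨t, hE', hA', hS'⟩ := h'
  exact ⟨_, hE.pair hE', fun k hk => (hA k hk).pair (hA' k hk),
    fun k hk => ⟨fun he => ((hS k hk).1 he).pair ((hS' k hk).1 he),
      fun ho => ((hS k hk).2 ho).pair ((hS' k hk).2 ho)⟩⟩

theorem IsAlvin.prod (h : IsAlvin V n) (h' : IsAlvin W n) : IsAlvin (varProd V W) n := by
  obtain ⟨s, hE, hA, hS⟩ := h
  obtain ⟨t, hE', hA', hS'⟩ := h'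
  exact ⟨_, hE.pair hE', fun k hk => (hA k hk).pair (hA' k hk),
    fun k hk => ⟨fun he => ((hS k hk).1 he).pair ((hS' k hk).1 he),
      fun ho => ((hS k hk).2 ho).pair ((hS' k hk).2 ho)⟩⟩

theorem IsDirectedDistributive.prod (h : IsDirectedDistributive V n)
    (h' : IsDirectedDistributive W n) : IsDirectedDistributive (varProd V W) n := by
  obtain ⟨s, hE, hA, hS⟩ := h
  obtain ⟨t, hE', hA', hS'⟩ := h'
  exact ⟨_, hE.pair hE', fun k hk => (hA k hk).pair (hA' k hk),
    fun k hk => (hS k hk).pair (hS' k hk)⟩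

theorem IsDirectedAlvinHeads.prod (h : IsDirectedAlvinHeads V n)
    (h' : IsDirectedAlvinHeads W n) : IsDirectedAlvinHeads (varProd V W) n := by
  obtain ⟨hn, p, t, q, ⟨hA, hp, hp2, hF, hq2, hq⟩, hpA, hqA⟩ := h
  obtain ⟨-, p', t', q', ⟨hA', hp', hp2', hF', hq2', hq'⟩, hpA', hqA'⟩ := h'
  refine ⟨hn, pairTerm p p', fun k => pairTerm (t k) (t' k), pairTerm q q',
    ⟨fun k h2 hk => (hA k h2 hk).pair (hA' k h2 hk), fun C hC x z => ?_, hp2.pair hp2',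
      fun k h2 hk => (hF k h2 hk).pair (hF' k h2 hk), hq2.pair hq2', fun C hC x z => ?_⟩,
    hpA.pair hpA', hqA.pair hqA'⟩ <;>
  obtain ⟨A, hA, B, hB, φ, ψ, hinj, h1, h2, -⟩ := exists_components hC
  · exact hinj _ _ (by rw [h1, hp A hA]) (by rw [h2, hp' B hB])
  · exact hinj _ _ (by rw [h1, hq A hA]) (by rw [h2, hq' B hB])

theorem DayBasic.pair {s : ℕ → L.Term (Fin 4)} {t : ℕ → M.Term (Fin 4)} (h : DayBasic V n s)
    (h' : DayBasic W n t) : DayBasic (varProd V W) n fun k => pairTerm (s k) (t k) := by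
  refine ⟨fun C hC x y z w => ?_, fun k hk C hC x y => ?_⟩ <;>
  obtain ⟨A, hA, B, hB, φ, ψ, hinj, -, -, h1, h2⟩ := exists_components hC
  · exact ⟨hinj _ _ (by rw [h1, (h.1 A hA _ _ _ _).1]) (by rw [h2, (h'.1 B hB _ _ _ _).1]),
      hinj _ _ (by rw [h1, (h.1 A hA _ _ _ _).2]) (by rw [h2, (h'.1 B hB _ _ _ _).2])⟩
  · exact hinj _ _ (by rw [h1, h.2 k hk A hA]) (by rw [h2, h'.2 k hk B hB])

theorem DayOuter.pair {s t : L.Term (Fin 4)} {s' t' : M.Term (Fin 4)} (h : DayOuter V s t)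
    (h' : DayOuter W s' t') : DayOuter (varProd V W) (pairTerm s s') (pairTerm t t') := by
  intro C hC x w
  obtain ⟨A, hA, B, hB, φ, ψ, hinj, -, -, h1, h2⟩ := exists_components hC
  exact hinj _ _ (by rw [h1, h1, h A hA]) (by rw [h2, h2, h' B hB])

theorem DayInner.pair {s t : L.Term (Fin 4)} {s' t' : M.Term (Fin 4)} (h : DayInner V s t)
    (h' : DayInner W s' t') : DayInner (varProd V W) (pairTerm s s') (pairTerm t t') := by
  intro C hC x y w
  obtain ⟨A, hA, B, hB, φ, ψ, hinj, -, -, h1, h2⟩ := exists_components hC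
  exact hinj _ _ (by rw [h1, h1, h A hA]) (by rw [h2, h2, h' B hB])

theorem IsModular.prod (h : IsModular V n) (h' : IsModular W n) : IsModular (varProd V W) n := by
  obtain ⟨s, hB, hS⟩ := h
  obtain ⟨t, hB', hS'⟩ := h'
  exact ⟨_, hB.pair hB', fun k hk => ⟨fun he => ((hS k hk).1 he).pair ((hS' k hk).1 he),
      fun ho => ((hS k hk).2 ho).pair ((hS' k hk).2 ho)⟩⟩

theorem IsReversedModular.prod (h : IsReversedModular V n) (h' : IsReversedModular W n) :
    IsReversedModular (varProd V W) n := by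
  obtain ⟨s, hB, hS⟩ := h
  obtain ⟨t, hB', hS'⟩ := h'
  exact ⟨_, hB.pair hB', fun k hk => ⟨fun he => ((hS k hk).1 he).pair ((hS' k hk).1 he),
      fun ho => ((hS k hk).2 ho).pair ((hS' k hk).2 ho)⟩⟩

end Product

/-! ### The generating algebras -/

/-- The operation `t_h` of the `i`-th generating algebra, which is a Boolean algebra if `b` is true
and a lattice otherwise. -/
noncomputable def genOp (b : Bool) (n i h : ℕ) : Bool → Bool → Bool → Bool :=
  bif b then boolOp n i h else latOp n i h

/-- The `i`-th generating algebra. -/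
noncomputable def gen (n : ℕ) (b : ℕ → Bool) (i : ℕ) : Bundled.{0} (sig n).Structure :=
  ternaryAlg n Bool (genOp (b i) n i)

/-- The generating algebras, the `i`-th one being Boolean if `b i` is true. -/
def gens (n : ℕ) (b : ℕ → Bool) : AlgClass (sig n) :=
  Set.range fun i : {i : ℕ // 1 ≤ i ∧ i ≤ n / 2} => gen n b i

section Generators

variable {n : ℕ} {b : ℕ → Bool}

theorem gen_eq_boolAlg {i : ℕ} (h : b i = true) : gen n b i = boolAlg Bool i n := by
  unfold gen boolAlg genOp
  rw [h]
  rfl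

theorem gen_eq_latAlg {i : ℕ} (h : b i = false) : gen n b i = latAlg Bool i n := by
  unfold gen latAlg genOp
  rw [h]
  rfl

theorem gen_mem_gens {i : ℕ} (h1 : 1 ≤ i) (h2 : i ≤ n / 2) : gen n b i ∈ gens n b :=
  ⟨⟨i, h1, h2⟩, rfl⟩

theorem Va_eq : Va n = variety (gens n fun i => decide (Even i)) := by
  unfold Va
  congr 1
  ext A
  constructor
  · rintro (⟨i, h1, h2, h3, rfl⟩ | ⟨i, h1, h2, h3, rfl⟩)
    · rw [← gen_eq_latAlg (b := fun i => decide (Even i)) (by simpa using h3)]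
      exact gen_mem_gens h1 h2
    · rw [← gen_eq_boolAlg (b := fun i => decide (Even i)) (by simpa using h3)]
      exact gen_mem_gens h1 h2
  · rintro ⟨⟨i, h1, h2⟩, rfl⟩
    rcases Nat.even_or_odd i with h | h
    · exact .inr ⟨i, h1, h2, h, gen_eq_boolAlg (by simpa using h)⟩
    · exact .inl ⟨i, h1, h2, h, gen_eq_latAlg (by simpa using h)⟩

theorem Vb_eq : Vb n = variety (gens n fun i => decide (Odd i)) := by
  unfold Vb
  congr 1
  ext A
  constructor
  · rintro (⟨i, h1, h2, h3, rfl⟩ | ⟨i, h1, h2, h3, rfl⟩)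
    · rw [← gen_eq_boolAlg (b := fun i => decide (Odd i)) (by simpa using h3)]
      exact gen_mem_gens h1 h2
    · rw [← gen_eq_latAlg (b := fun i => decide (Odd i)) (by simpa using h3)]
      exact gen_mem_gens h1 h2
  · rintro ⟨⟨i, h1, h2⟩, rfl⟩
    rcases Nat.even_or_odd i with h | h
    · exact .inr ⟨i, h1, h2, h, gen_eq_latAlg (by simpa using h)⟩
    · exact .inl ⟨i, h1, h2, h, gen_eq_boolAlg (by simpa using h)⟩

theorem Vc_eq : Vc n = variety (gens n fun _ => false) := by
  unfold Vc
  congr 1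
  ext A
  constructor
  · rintro ⟨i, h1, h2, rfl⟩
    exact gen_mem_gens (b := fun _ => false) h1 h2
  · rintro ⟨⟨i, h1, h2⟩, rfl⟩
    exact ⟨i, h1, h2, rfl⟩

theorem Vd_eq (hn : 2 ≤ n) : Vd n = variety (gens n fun i => decide (i = 1)) := by
  unfold Vd
  congr 1
  ext A
  constructor
  · rintro (rfl | ⟨i, h1, h2, rfl⟩)
    · exact gen_mem_gens (b := fun i => decide (i = 1)) le_rfl (by omega)
    · rw [← gen_eq_latAlg (b := fun i => decide (i = 1)) (by simp; omega)]
      exact gen_mem_gens (by omega) h2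
  · rintro ⟨⟨i, h1, h2⟩, rfl⟩
    by_cases h : i = 1
    · subst h
      exact .inl rfl
    · exact .inr ⟨i, by omega, h2, gen_eq_latAlg (by simpa using h)⟩

/-- The value of a term under interpretation of `t_h` as `op h` on `Bool`. -/
def evalB {κ : Type} (op : ℕ → Bool → Bool → Bool → Bool) (t : (sig n).Term κ) (v : κ → Bool) :
    Bool :=
  Term.realize (M := ternaryAlg n Bool op) v t

/-- The operation symbol `t_h`. -/
def opSymb (h : ℕ) (h1 : 0 < h) (h2 : h < n) : (sig n).Functions 3 := TernarySymb.t h h1 h2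

@[simp] theorem evalB_func {κ : Type} (op : ℕ → Bool → Bool → Bool → Bool) (h : ℕ) (h1 : 0 < h)
    (h2 : h < n) (ts : Fin 3 → (sig n).Term κ) (v : κ → Bool) :
    evalB op (.func (opSymb h h1 h2) ts) v =
      op h (evalB op (ts 0) v) (evalB op (ts 1) v) (evalB op (ts 2) v) := rfl

/-- The term `t_h(x, y, z)`, extended by `t_0(x, y, z) = x` and `t_h(x, y, z) = z` for `h ≥ n`. -/
def opTerm (n h : ℕ) : (sig n).Term (Fin 3) :=
  if h1 : 0 < h then if h2 : h < n then .func (opSymb h h1 h2) Term.var else tv 2 else tv 0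

/-- Writing y or its complement as `xor c y` gives one formula for both kinds of generators, ready
for case splitting. -/
theorem genOp_eq (c : Bool) (n i h : ℕ) (x y z : Bool) : genOp c n i h x y z =
    if h < i then x
    else if h = i then
      (if 2 * i = n then (x && xor c y) || (x && z) || (xor c y && z) else x && (xor c y || z))
    else if h < n - i then x && z
    else if h = n - i then z && (xor c y || x)
    else z := by
  cases c
  · simp only [genOp, cond_false, latOp, Bool.false_xor]
    rfl
  · simp only [genOp, cond_true, boolOp, Bool.true_xor]
    rfl

theorem genOp_zero {c : Bool} {i : ℕ} (hi : 1 ≤ i) (x y z : Bool) : genOp c n i 0 x y z = x := by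
  cases c <;> simp [genOp, latOp, boolOp, show 0 < i by omega]

theorem genOp_of_le {c : Bool} {i h : ℕ} (hi : 1 ≤ i) (hin : i ≤ n / 2) (hh : n ≤ h)
    (x y z : Bool) : genOp c n i h x y z = z := by
  cases c <;> simp [genOp, latOp, boolOp, show ¬ h < i by omega, show h ≠ i by omega,
    show ¬ h < n - i by omega, show ¬ h = n - i by omega]

/-- The formulas for t_h already yield x at h = 0 and z for h ≥ n, so the ends of the chain need no
separate treatment. -/
theorem ev3_opTerm {i : ℕ} (hi : 1 ≤ i) (hin : i ≤ n / 2) (h : ℕ) (x y z : gen n b i) :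
    ev3 (opTerm n h) x y z = genOp (b i) n i h x y z := by
  unfold opTerm
  split_ifs with h1 h2
  · rfl
  · exact (genOp_of_le hi hin (by omega) _ _ _).symm
  · obtain rfl : h = 0 := by omega
    exact (genOp_zero hi _ _ _).symm

/-- The term `t_h(x, t_h(x, y, z), z)`. -/
def dirTerm (n h : ℕ) : (sig n).Term (Fin 3) :=
  app3 (opTerm n h) (tv 0) (opTerm n h) (tv 2)

/-- The two complements cancel: for example, x((x(y'+z))'+z) = x(y+z), while the lattice operations
are unchanged by the nesting. -/
theorem ev3_dirTerm {i : ℕ} (hi : 1 ≤ i) (hin : i ≤ n / 2) (h : ℕ) (x y z : gen n b i) :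
    ev3 (dirTerm n h) x y z = latOp (L := Bool) n i h x y z := by
  unfold dirTerm
  rw [ev3_app3, ev3_opTerm hi hin, ev3_opTerm hi hin]
  change genOp (b i) n i h x (genOp (b i) n i h x y z) z = _
  have key : ∀ x y z : Bool,
      genOp (b i) n i h x (genOp (b i) n i h x y z) z = latOp n i h x y z := by
    cases b i
    · simp only [genOp, cond_false, latOp]
      split_ifs <;> decide
    · simp only [genOp, cond_true, latOp, boolOp]
      split_ifs <;> decide
  exact key x y z

theorem forall_gens {P : Bundled.{0} (sig n).Structure → Prop}
    (h : ∀ i, 1 ≤ i → i ≤ n / 2 → P (gen n b i)) : ∀ A ∈ gens n b, P A := by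
  rintro _ ⟨⟨i, h1, h2⟩, rfl⟩
  exact h i h1 h2

theorem ends_opTerm (hn : 2 ≤ n) : Ends (gens n b) n (opTerm n) := by
  refine fun A _ x y z => ⟨?_, ?_⟩
  · simp [opTerm]
  · simp [opTerm, show 0 < n by omega]

theorem absorbs_opTerm (h : ℕ) : Absorbs (gens n b) (opTerm n h) := by
  refine forall_gens fun i h1 h2 x y => ?_
  rw [ev3_opTerm h1 h2]
  have key : ∀ x y : Bool, genOp (b i) n i h x y x = x := by
    cases b i
    · simp only [genOp, cond_false, latOp]
      split_ifs <;> decide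
    · simp only [genOp, cond_true, boolOp]
      split_ifs <;> decide
  exact key x y

theorem absorbs_dirTerm (h : ℕ) : Absorbs (gens n b) (dirTerm n h) := by
  intro A hA x y
  simp only [dirTerm, ev3_app3, ev3_var0, ev3_var2]
  exact absorbs_opTerm h A hA _ _

/-- Only h and h + 1 near i and n - i matter. A lattice is needed at h = i - 1 and h = n - i - 1, a
Boolean algebra at h = i and h = n - i; for even n these demands agree with the parity condition. -/
theorem genOp_alternating_left (he : Even n) {i h : ℕ} (hi : 1 ≤ i) (hin : i ≤ n / 2) {c : Bool}
    (hc : c = decide (Odd (i + h + 1))) (x z : Bool) :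
    genOp c n i h x x z = genOp c n i (h + 1) x x z := by
  rw [genOp_eq, genOp_eq]
  subst hc
  by_cases hp : Odd (i + h + 1) <;> simp only [hp, decide_true, decide_false] <;> split_ifs <;>
    first | (exfalso; grind) | (revert x z; decide)

theorem genOp_alternating_right (he : Even n) {i h : ℕ} (hi : 1 ≤ i) (hin : i ≤ n / 2) {c : Bool}
    (hc : c = decide (Even (i + h + 1))) (x z : Bool) :
    genOp c n i h x z z = genOp c n i (h + 1) x z z := by
  rw [genOp_eq, genOp_eq]
  subst hc
  by_cases hp : Even (i + h + 1) <;> simp only [hp, decide_true, decide_false] <;> split_ifs <;>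
    first | (exfalso; grind) | (revert x z; decide)

/-- The generators alternate between lattices and Boolean algebras, starting with a lattice. -/
theorem isDistributive_gens (hn : 2 ≤ n) (he : Even n) :
    IsDistributive (gens n fun i => decide (Even i)) n := by
  refine ⟨opTerm n, ends_opTerm hn, fun h _ => absorbs_opTerm h,
    fun h hh => ⟨fun hE => ?_, fun hO => ?_⟩⟩
  · refine forall_gens fun i h1 h2 x z => ?_
    rw [ev3_opTerm h1 h2, ev3_opTerm h1 h2]
    exact genOp_alternating_left he h1 h2 (by simp; grind) x z
  · refine forall_gens fun i h1 h2 x z => ?_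
    rw [ev3_opTerm h1 h2, ev3_opTerm h1 h2]
    exact genOp_alternating_right he h1 h2 (by simp; grind) x z

theorem isAlvin_gens (hn : 2 ≤ n) (he : Even n) :
    IsAlvin (gens n fun i => decide (Odd i)) n := by
  refine ⟨opTerm n, ends_opTerm hn, fun h _ => absorbs_opTerm h,
    fun h hh => ⟨fun hE => ?_, fun hO => ?_⟩⟩
  · refine forall_gens fun i h1 h2 x z => ?_
    rw [ev3_opTerm h1 h2, ev3_opTerm h1 h2]
    exact genOp_alternating_right he h1 h2 (by simp; grind) x z
  · refine forall_gens fun i h1 h2 x z => ?_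
    rw [ev3_opTerm h1 h2, ev3_opTerm h1 h2]
    exact genOp_alternating_left he h1 h2 (by simp; grind) x z

theorem latOp_eq_genOp (n i h : ℕ) : latOp (L := Bool) n i h = genOp false n i h := rfl

/-- Idempotence and absorption suffice: x = x(x+z), x(z+z) = xz, xz = z(x+x) and z(z+x) = z. -/
theorem latOp_forward {i : ℕ} (h1 : 1 ≤ i) (h2 : i ≤ n / 2) (h : ℕ) (x z : Bool) :
    latOp n i h x z z = latOp n i (h + 1) x x z := by
  rw [latOp_eq_genOp, latOp_eq_genOp, genOp_eq, genOp_eq]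
  split_ifs <;> first | omega | (revert x z; decide)

theorem isDirectedDistributive_gens (hn : 2 ≤ n) : IsDirectedDistributive (gens n b) n := by
  refine ⟨dirTerm n, fun A hA x y z => ?_, fun h _ => absorbs_dirTerm h, fun h hh => ?_⟩
  · simp only [dirTerm, ev3_app3, (ends_opTerm hn A hA _ _ _).1, (ends_opTerm hn A hA _ _ _).2,
      ev3_var0, ev3_var2, and_self]
  · refine forall_gens fun i h1 h2 x z => ?_
    rw [ev3_dirTerm h1 h2, ev3_dirTerm h1 h2]
    exact latOp_forward h1 h2 h x z

/-- In the Boolean first generator, x(z'+z) = x and x(x'+z) = xz. In all other generators t_1 and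
t_{n-1} are projections. -/
theorem genOp_head {c : Bool} {i : ℕ} (hn : 4 ≤ n) (hi : 1 ≤ i) (hin : i ≤ n / 2)
    (hc : i = 1 → c = true) (x z : Bool) :
    genOp c n i 1 x z z = x ∧ genOp c n i 1 x x z = latOp n i 2 x x z ∧
    latOp n i (n - 2) x z z = genOp c n i (n - 1) x z z ∧ genOp c n i (n - 1) x x z = z := by
  rw [latOp_eq_genOp, latOp_eq_genOp]
  simp only [genOp_eq]
  by_cases h1 : i = 1
  · obtain rfl := hc h1
    refine ⟨?_, ?_, ?_, ?_⟩ <;> split_ifs <;> first | omega | (revert x z; decide)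
  · refine ⟨?_, ?_, ?_, ?_⟩ <;> split_ifs <;> first | omega | (revert x z; decide)

theorem isDirectedAlvinHeads_gens (hn : 4 ≤ n) (hb : b 1 = true) :
    IsDirectedAlvinHeads (gens n b) n := by
  have key : ∀ i, 1 ≤ i → i ≤ n / 2 → ∀ x z : Bool, _ := fun i h1 h2 =>
    genOp_head (c := b i) hn h1 h2 (by rintro rfl; exact hb)
  refine ⟨hn, opTerm n 1, dirTerm n, opTerm n (n - 1), ⟨fun h _ _ => absorbs_dirTerm h, ?_, ?_, ?_,
    ?_, ?_⟩, absorbs_opTerm _, absorbs_opTerm _⟩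
  · refine forall_gens fun i h1 h2 x z => ?_
    rw [ev3_opTerm h1 h2]
    exact (key i h1 h2 x z).1
  · refine forall_gens fun i h1 h2 x z => ?_
    rw [ev3_opTerm h1 h2, ev3_dirTerm h1 h2]
    exact (key i h1 h2 x z).2.1
  · intro h _ _
    refine forall_gens fun i h1 h2 x z => ?_
    rw [ev3_dirTerm h1 h2, ev3_dirTerm h1 h2]
    exact latOp_forward h1 h2 h x z
  · refine forall_gens fun i h1 h2 x z => ?_
    rw [ev3_opTerm h1 h2, ev3_dirTerm h1 h2]
    exact (key i h1 h2 x z).2.2.1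
  · refine forall_gens fun i h1 h2 x z => ?_
    rw [ev3_opTerm h1 h2]
    exact (key i h1 h2 x z).2.2.2

theorem isModular_gens_two (hb : b 1 = true) : IsModular (gens 2 b) 2 := by
  have hp : ∀ x y z : gen 2 b 1,
      ev3 (opTerm 2 1) x y z = ((x && !y) || (x && z) || (!y && z) : Bool) := by
    intro x y z
    rw [ev3_opTerm le_rfl le_rfl]
    have key : ∀ x y z : Bool, genOp (b 1) 2 1 1 x y z = (x && !y || x && z || !y && z) := by
      simp [genOp_eq, hb]
    exact key x y z
  have h1 : ∀ P : Bundled.{0} (sig 2).Structure → Prop, P (gen 2 b 1) → ∀ A ∈ gens 2 b, P A := by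
    intro P hP
    refine forall_gens fun i h1 h2 => ?_
    obtain rfl : i = 1 := by omega
    exact hP
  -- With complemented y, the majority operation is a Pixley operation p, so p(x,p(x,y,z),w) is x on
  -- (x,x,w,w) and w on (x,y,y,w). Two-headed terms, available only from n = 4 on, cannot be used
  -- here.
  refine ⟨fun k => if k = 0 then tv 0 else if k = 1 then app3 (opTerm 2 1) (tv 0)
    (app3 (opTerm 2 1) (tv 0) (tv 1) (tv 2)) (tv 3) else tv 3, ⟨?_, ?_⟩, ?_⟩
  · exact fun A _ x y z w => ⟨rfl, rfl⟩
  · intro k hk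
    obtain rfl | rfl | rfl : k = 0 ∨ k = 1 ∨ k = 2 := by omega
    · exact fun A _ _ _ => rfl
    · intro A hA x y
      simp only [if_true, if_neg one_ne_zero, ev4_app3, ev4_var0, ev4_var3]
      exact absorbs_opTerm 1 A hA _ _
    · exact fun A _ _ _ => rfl
  · intro k hk
    obtain rfl | rfl : k = 0 ∨ k = 1 := by omega
    · refine ⟨fun _ => h1 _ fun x w => ?_, fun h => by simp at h⟩
      change x = ev4 (app3 _ _ (app3 _ _ _ _) _) x x w w
      rw [ev4_app3, ev4_app3, hp, hp]
      exact (by decide : ∀ x w : Bool, x = ((x && !((x && !x) || (x && w) || (!x && w))) || (x && w) ||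
        (!((x && !x) || (x && w) || (!x && w)) && w))) x w
    · refine ⟨fun h => by simp at h, fun _ => h1 _ fun x y w => ?_⟩
      change ev4 (app3 _ _ (app3 _ _ _ _) _) x y y w = w
      rw [ev4_app3, ev4_app3, hp, hp]
      exact (by decide : ∀ x y w : Bool, ((x && !((x && !y) || (x && y) || (!y && y))) || (x && w) ||
        (!((x && !y) || (x && y) || (!y && y)) && w)) = w) x y w

end Generators

/-! ### Evaluation in the first generating algebra -/

section Eval

variable {n : ℕ} {κ : Type}

theorem evalB_mono {i : ℕ} (t : (sig n).Term κ) {v w : κ → Bool} (hvw : ∀ j, v j = true → w j = true)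
    (h : evalB (genOp false n i) t v = true) : evalB (genOp false n i) t w = true := by
  induction t with
  | var j => exact hvw j h
  | func f ts ih =>
    obtain ⟨k, h1, h2⟩ := f
    change evalB _ (.func (opSymb k h1 h2) ts) v = true at h
    change evalB _ (.func (opSymb k h1 h2) ts) w = true
    rw [evalB_func, genOp_eq] at h ⊢
    have e0 := ih 0
    have e1 := ih 1
    have e2 := ih 2
    simp only [Bool.false_xor] at h ⊢
    split_ifs at h ⊢ <;> (try simp only [Bool.and_eq_true, Bool.or_eq_true] at h ⊢) <;> tauto

/-- For i = 1 the operations are x(·), xz and z(·). The case n = 2 is excluded because there t_1 is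
of majority type and lies below neither outer argument. -/
theorem evalB_genOp_one {c : Bool} (hn : 3 ≤ n) {h : ℕ} {h1 : 0 < h} {h2 : h < n}
    {ts : Fin 3 → (sig n).Term κ} {v : κ → Bool}
    (hv : evalB (genOp c n 1) (.func (opSymb h h1 h2) ts) v = true) :
    (h ≠ n - 1 → evalB (genOp c n 1) (ts 0) v = true) ∧
      (h ≠ 1 → evalB (genOp c n 1) (ts 2) v = true) := by
  rw [evalB_func, genOp_eq] at hv
  split_ifs at hv <;> (try simp only [Bool.and_eq_true, Bool.or_eq_true] at hv) <;>
    first | (exfalso; omega) | (constructor <;> intro <;> first | (exfalso; omega) | tauto)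

/-- Descending to the first or third argument ends in a variable. This serves the base case n = 3,
below which no variety is left for `star`. -/
theorem exists_le_var {c : Bool} (hn : 3 ≤ n) (t : (sig n).Term κ) :
    ∃ j, ∀ v, evalB (genOp c n 1) t v = true → v j = true := by
  induction t with
  | var j => exact ⟨j, fun v h => h⟩
  | func f ts ih =>
    obtain ⟨k, h1, h2⟩ := f
    by_cases hk : k = n - 1
    · obtain ⟨j, hj⟩ := ih 2
      exact ⟨j, fun v hv => hj v ((evalB_genOp_one hn (h1 := h1) (h2 := h2) hv).2 (by omega))⟩
    · obtain ⟨j, hj⟩ := ih 0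
      exact ⟨j, fun v hv => hj v ((evalB_genOp_one hn (h1 := h1) (h2 := h2) hv).1 hk)⟩

/-- The term for `sig n` which results from a term for `sig (n + 2)` by replacing `t_1` and
`t_{n + 1}` by the first and the third projection and by renaming `t_{h + 1}` to `t_h`. -/
def star : (sig (n + 2)).Term κ → (sig n).Term κ
  | .var j => .var j
  | .func (.t h h1 h2) ts =>
    if h3 : h = 1 then star (ts 0)
    else if h4 : h = n + 1 then star (ts 2)
    else .func (opSymb (h - 1) (by omega) (by omega)) fun j => star (ts j)

theorem star_func (h : ℕ) (h1 : 0 < h) (h2 : h < n + 2) (ts : Fin 3 → (sig (n + 2)).Term κ) :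
    star (.func (opSymb h h1 h2) ts) = if h3 : h = 1 then star (ts 0)
    else if h4 : h = n + 1 then star (ts 2)
    else .func (opSymb (h - 1) (by omega) (by omega)) fun j => star (ts j) := by
  unfold opSymb
  rw [star]
  rfl

/-- In generator i + 1 for n + 2, the outermost operations are projections and the others are those
of generator i for n, so nothing is lost by `star`. -/
theorem evalB_star {c : Bool} {i : ℕ} (hi : 1 ≤ i) (hin : i ≤ n / 2) (t : (sig (n + 2)).Term κ)
    (v : κ → Bool) : evalB (genOp c n i) (star t) v = evalB (genOp c (n + 2) (i + 1)) t v := by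
  induction t with
  | var j => rfl
  | func f ts ih =>
    obtain ⟨h, h1, h2⟩ := f
    change evalB _ (star (.func (opSymb h h1 h2) ts)) v = evalB _ (.func (opSymb h h1 h2) ts) v
    rw [star_func, evalB_func]
    split_ifs with h3 h4
    · rw [ih, genOp_eq, if_pos (by omega)]
    · rw [ih, genOp_eq, if_neg (by omega), if_neg (by omega), if_neg (by omega), if_neg (by omega)]
    · rw [evalB_func, ih, ih, ih, genOp_eq, genOp_eq]
      have e1 : h - 1 < i ↔ h < i + 1 := by omega
      have e2 : h - 1 = i ↔ h = i + 1 := by omega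
      have e3 : 2 * i = n ↔ 2 * (i + 1) = n + 2 := by omega
      have e4 : h - 1 < n - i ↔ h < n + 2 - (i + 1) := by omega
      have e5 : h - 1 = n - i ↔ h = n + 2 - (i + 1) := by omega
      simp only [e1, e2, e3, e4, e5]

/-- If a term takes the value `1` in the first generating algebra at all points of `F`, where `x_j`
is the only variable with this property, then `star t` is the projection to `x_j` in all
generating algebras of the next smaller variety. -/
theorem evalB_star_eq_var {c d : Bool} (hn : 2 ≤ n) {F : Set (κ → Bool)} {j : κ}
    (hF : ∀ j', (∀ a ∈ F, a j' = true) → j' = j) (t : (sig (n + 2)).Term κ)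
    (ht : ∀ a ∈ F, evalB (genOp c (n + 2) 1) t a = true) (i : ℕ)
    (v : κ → Bool) : evalB (genOp d n i) (star t) v = v j := by
  induction t with
  | var j' =>
    rw [← hF j' ht]
    rfl
  | func f ts ih =>
    obtain ⟨h, h1, h2⟩ := f
    change evalB _ (star (.func (opSymb h h1 h2) ts)) v = _
    have key := fun a ha => evalB_genOp_one (by omega) (h1 := h1) (h2 := h2) (ht a ha)
    rw [star_func]
    split_ifs with h3 h4
    · exact ih 0 fun a ha => (key a ha).1 (by omega)
    · exact ih 2 fun a ha => (key a ha).2 (by omega)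
    · rw [evalB_func, ih 0 fun a ha => (key a ha).1 (by omega),
        ih 2 fun a ha => (key a ha).2 (by omega)]
      -- The middle argument is not controlled; since both outer arguments evaluate to v j,
      -- absorption makes it irrelevant.
      have habs : ∀ x y : Bool, genOp d n i (h - 1) x y x = x := by
        intro x y
        rw [genOp_eq]
        split_ifs <;> (revert x y; cases d <;> decide)
      exact habs _ _

end Eval

/-! ### Passing from n + 2 to n by deleting the first generator -/

section Reduction

variable {n : ℕ} {b : ℕ → Bool}

/-- The map φ is the identity on `Bool`; this form allows the transfer lemmas for interpretations to
be reused. -/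
theorem exists_gens_ev4 : ∀ A ∈ gens n (fun i => b (i + 1)), ∃ C ∈ gens (n + 2) b, ∃ φ : C → A,
    Function.Surjective φ ∧ ∀ (t : (sig (n + 2)).Term (Fin 4)) (x y z w : C),
      φ (ev4 t x y z w) = ev4 (star t) (φ x) (φ y) (φ z) (φ w) :=
  forall_gens fun i h1 h2 => ⟨gen (n + 2) b (i + 1), gen_mem_gens (by omega) (by omega),
    fun x : Bool => (x : Bool), fun x => ⟨x, rfl⟩, fun t x y z w =>
      (evalB_star h1 h2 t ![(x : Bool), y, z, w]).symm⟩

theorem star_eqLeft {s t : (sig (n + 2)).Term (Fin 3)} (h : EqLeft (gens (n + 2) b) s t) :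
    EqLeft (gens n fun i => b (i + 1)) (star s) (star t) :=
  forall_gens fun i h1 h2 x z =>
    (evalB_star h1 h2 s ![(x : Bool), x, z]).trans <|
      (h (gen (n + 2) b (i + 1)) (gen_mem_gens (by omega) (by omega)) x z).trans
        (evalB_star h1 h2 t ![(x : Bool), x, z]).symm

theorem star_eqRight {s t : (sig (n + 2)).Term (Fin 3)} (h : EqRight (gens (n + 2) b) s t) :
    EqRight (gens n fun i => b (i + 1)) (star s) (star t) :=
  forall_gens fun i h1 h2 x z =>
    (evalB_star h1 h2 s ![(x : Bool), z, z]).trans <|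
      (h (gen (n + 2) b (i + 1)) (gen_mem_gens (by omega) (by omega)) x z).trans
        (evalB_star h1 h2 t ![(x : Bool), z, z]).symm

theorem star_absorbs {t : (sig (n + 2)).Term (Fin 3)} (h : Absorbs (gens (n + 2) b) t) :
    Absorbs (gens n fun i => b (i + 1)) (star t) :=
  forall_gens fun i h1 h2 x y =>
    (evalB_star h1 h2 t ![(x : Bool), y, x]).trans
      (h (gen (n + 2) b (i + 1)) (gen_mem_gens (by omega) (by omega)) x y)

/-- The value of a term in the first generating algebra. -/
noncomputable abbrev eval₁ {κ : Type} (b : ℕ → Bool) (t : (sig n).Term κ) (v : κ → Bool) : Bool :=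
  evalB (genOp (b 1) n 1) t v

theorem eval₁_mono {κ : Type} (hb : b 1 = false) {t : (sig n).Term κ} {v w : κ → Bool}
    (h : eval₁ b t v = true) (hvw : ∀ j, v j = true → w j = true) : eval₁ b t w = true := by
  unfold eval₁ at *
  rw [hb] at *
  exact evalB_mono t hvw h

theorem eval₁_eq_of_dayOuter (hn : 2 ≤ n) {s t : (sig n).Term (Fin 4)}
    (h : DayOuter (gens n b) s t) (x w : Bool) :
    eval₁ b s ![x, x, w, w] = eval₁ b t ![x, x, w, w] :=
  h (gen n b 1) (gen_mem_gens le_rfl (by omega)) x w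

theorem eval₁_eq_of_dayInner (hn : 2 ≤ n) {s t : (sig n).Term (Fin 4)}
    (h : DayInner (gens n b) s t) (x y w : Bool) :
    eval₁ b s ![x, y, y, w] = eval₁ b t ![x, y, y, w] :=
  h (gen n b 1) (gen_mem_gens le_rfl (by omega)) x y w

theorem eval₁_dayBasic_zero (hn : 2 ≤ n) {m : ℕ} {u : ℕ → (sig n).Term (Fin 4)}
    (h : DayBasic (gens n b) m u) (x y z w : Bool) : eval₁ b (u 0) ![x, y, z, w] = x :=
  (h.1 (gen n b 1) (gen_mem_gens le_rfl (by omega)) x y z w).1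

theorem eval₁_dayBasic_last (hn : 2 ≤ n) {m : ℕ} {u : ℕ → (sig n).Term (Fin 4)}
    (h : DayBasic (gens n b) m u) (x y z w : Bool) : eval₁ b (u m) ![x, y, z, w] = w :=
  (h.1 (gen n b 1) (gen_mem_gens le_rfl (by omega)) x y z w).2

theorem eval₁_dayBasic_absorbs (hn : 2 ≤ n) {m : ℕ} {u : ℕ → (sig n).Term (Fin 4)}
    (h : DayBasic (gens n b) m u) {k : ℕ} (hk : k ≤ m) (x y : Bool) :
    eval₁ b (u k) ![x, y, y, x] = x :=
  h.2 k hk (gen n b 1) (gen_mem_gens le_rfl (by omega)) x y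

theorem eval₁_eq_of_eqLeft (hn : 2 ≤ n) {s t : (sig n).Term (Fin 3)}
    (h : EqLeft (gens n b) s t) (x z : Bool) : eval₁ b s ![x, x, z] = eval₁ b t ![x, x, z] :=
  h (gen n b 1) (gen_mem_gens le_rfl (by omega)) x z

theorem eval₁_eq_of_eqRight (hn : 2 ≤ n) {s t : (sig n).Term (Fin 3)}
    (h : EqRight (gens n b) s t) (x z : Bool) : eval₁ b s ![x, z, z] = eval₁ b t ![x, z, z] :=
  h (gen n b 1) (gen_mem_gens le_rfl (by omega)) x z

theorem eval₁_of_absorbs (hn : 2 ≤ n) {t : (sig n).Term (Fin 3)}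
    (h : Absorbs (gens n b) t) (x y : Bool) : eval₁ b t ![x, y, x] = x :=
  h (gen n b 1) (gen_mem_gens le_rfl (by omega)) x y

theorem eval₁_ends (hn : 2 ≤ n) {m : ℕ} {t : ℕ → (sig n).Term (Fin 3)}
    (h : Ends (gens n b) m t) (x y z : Bool) :
    eval₁ b (t 0) ![x, y, z] = x ∧ eval₁ b (t m) ![x, y, z] = z :=
  h (gen n b 1) (gen_mem_gens le_rfl (by omega)) x y z

theorem star_eq_var {κ : Type} (hn : 2 ≤ n) {F : Set (κ → Bool)} {j : κ}
    (hF : ∀ j', (∀ a ∈ F, a j' = true) → j' = j) (t : (sig (n + 2)).Term κ)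
    (ht : ∀ a ∈ F, eval₁ b t a = true) :
    ∀ A ∈ gens n (fun i => b (i + 1)), ∀ v : κ → A, (star t).realize v = v j :=
  forall_gens fun i _ _ v => evalB_star_eq_var hn hF t ht i v

/-- One of the points will be the absorption point, where only the outer variables are 1, and the
other will decide between them. -/
theorem star_eq_of_two {κ : Type} (hn : 2 ≤ n) {a a' : κ → Bool} {j : κ}
    (hF : ∀ j', a j' = true → a' j' = true → j' = j) {t : (sig (n + 2)).Term κ}
    (ha : eval₁ b t a = true) (ha' : eval₁ b t a' = true) :
    ∀ A ∈ gens n (fun i => b (i + 1)), ∀ v : κ → A, (star t).realize v = v j :=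
  star_eq_var hn (F := {a, a'}) (by simpa using hF) t (by simpa using ⟨ha, ha'⟩)

/-! ### Lower bounds for the modular levels -/

/-- If the first generating algebra is a lattice, then reversed Day terms stay close to the
first projection for three steps, and symmetrically at the end. -/
theorem eval₁_reversedDay (hn : 2 ≤ n) (hb : b 1 = false) {m : ℕ} {u : ℕ → (sig n).Term (Fin 4)}
    (hB : DayBasic (gens n b) m u) (hS : ∀ k < m, (Even k → DayInner (gens n b) (u k) (u (k + 1))) ∧
      (Odd k → DayOuter (gens n b) (u k) (u (k + 1)))) (hm : 3 ≤ m) (ho : Odd m) :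
    eval₁ b (u 3) ![true, true, true, false] = true ∧
      eval₁ b (u (m - 2)) ![false, false, true, true] = true ∧
      eval₁ b (u (m - 3)) ![false, true, true, true] = true := by
  -- The value 1 is carried along (1,0,0,0), (1,1,0,0), (1,1,1,0): an identity moves to the next
  -- term, then monotonicity raises one variable so that the next identity applies. The other end is
  -- the mirror image.
  have h0 := eval₁_dayBasic_zero hn hB true false false false
  rw [eval₁_eq_of_dayInner hn ((hS 0 (by omega)).1 (by simp))] at h0
  have h1 := eval₁_mono hb h0 (w := ![true, true, false, false]) (by decide)
  rw [eval₁_eq_of_dayOuter hn ((hS 1 (by omega)).2 (by simp))] at h1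
  have h2 := eval₁_mono hb h1 (w := ![true, true, true, false]) (by decide)
  rw [eval₁_eq_of_dayInner hn ((hS 2 (by omega)).1 (by simp))] at h2
  refine ⟨h2, ?_⟩
  have g0 := eval₁_dayBasic_last hn hB false false false true
  have e1 := (hS (m - 1) (by omega)).1 (by grind)
  have e2 := (hS (m - 2) (by omega)).2 (by grind)
  have e3 := (hS (m - 3) (by omega)).1 (by grind)
  rw [show m - 1 + 1 = m by omega] at e1
  rw [show m - 2 + 1 = m - 1 by omega] at e2
  rw [show m - 3 + 1 = m - 2 by omega] at e3
  rw [← eval₁_eq_of_dayInner hn e1] at g0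
  have g1 := eval₁_mono hb g0 (w := ![false, false, true, true]) (by decide)
  rw [← eval₁_eq_of_dayOuter hn e2] at g1
  have g2 := eval₁_mono hb g1 (w := ![false, true, true, true]) (by decide)
  rw [← eval₁_eq_of_dayInner hn e3] at g2
  exact ⟨g1, g2⟩

theorem not_isReversedModular_gens_two (hb : b 1 = false) : ¬ IsReversedModular (gens 2 b) 3 := by
  rintro ⟨u, hB, hS⟩
  have h := (eval₁_reversedDay le_rfl hb hB hS le_rfl (by decide)).1
  rw [eval₁_dayBasic_last le_rfl hB] at h
  cases h

/-- For m = 5, u_3 is reached from both ends: it is 1 at (1,1,1,0), (0,0,1,1) and (1,0,0,1), but no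
variable is 1 at all three points. -/
theorem not_isReversedModular_gens_three (hb : b 1 = false) :
    ¬ IsReversedModular (gens 3 b) 5 := by
  rintro ⟨u, hB, hS⟩
  obtain ⟨h1, h2, -⟩ := eval₁_reversedDay (by omega) hb hB hS (by omega) (by decide)
  have h3 := eval₁_dayBasic_absorbs (by omega) hB (show 3 ≤ 5 by omega) true false
  obtain ⟨j, hj⟩ := exists_le_var (c := b 1) le_rfl (u 3)
  have e1 := hj _ h1
  have e2 := hj _ h2
  have e3 := hj _ h3
  revert e1 e2 e3
  revert j
  have : ∀ j : Fin 4, ![true, true, true, false] j = true → ![false, false, true, true] j = true →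
      ![true, false, false, true] j = true → False := by decide
  exact fun j _ => this j

/-- Under `star`, u_3 and the third term from the end become x and w. Dropping three links at each
end leaves 2n + 3 - 6 of them, and the odd shift exchanges inner and outer. -/
theorem IsReversedModular.reduce (hn : 2 ≤ n) (hb : b 1 = false)
    (h : IsReversedModular (gens (n + 2) b) (2 * n + 3)) :
    IsModular (gens n fun i => b (i + 1)) (2 * n - 3) := by
  obtain ⟨u, hB, hS⟩ := h
  obtain ⟨h1, -, h2⟩ := eval₁_reversedDay (by omega) hb hB hS (by omega) (by grind)
  have h1' := eval₁_dayBasic_absorbs (by omega) hB (show 3 ≤ 2 * n + 3 by omega) true false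
  have h2' := eval₁_dayBasic_absorbs (by omega) hB (show 2 * n + 3 - 3 ≤ 2 * n + 3 by omega) true false
  have s1 := star_eq_of_two hn (j := 0) (by decide) h1 h1'
  have s2 := star_eq_of_two hn (j := 3) (by decide) h2 h2'
  have hB' := Interpretable.dayBasic exists_gens_ev4 hB
  refine ⟨fun k => star (u (k + 3)), ⟨fun A hA x y z w => ⟨s1 A hA _, ?_⟩,
    fun k hk => hB'.2 (k + 3) (by omega)⟩, fun k hk => ⟨fun he => ?_, fun ho => ?_⟩⟩
  · dsimp only
    rw [show 2 * n - 3 + 3 = 2 * n + 3 - 3 by omega]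
    exact s2 A hA _
  · exact Interpretable.dayOuter exists_gens_ev4 ((hS (k + 3) (by omega)).2 (by grind))
  · exact Interpretable.dayInner exists_gens_ev4 ((hS (k + 3) (by omega)).1 (by grind))

/-- The first outer identity alone gives u_1 the value 1 at (1,1,0,0), without monotonicity. Hence
one link is lost at each end for either kind of first generator. -/
theorem IsModular.reduce (hn : 2 ≤ n) (h : IsModular (gens (n + 2) b) (2 * n + 1)) :
    IsReversedModular (gens n fun i => b (i + 1)) (2 * n - 1) := by
  obtain ⟨u, hB, hS⟩ := h
  have h1 := eval₁_dayBasic_zero (by omega) hB true true false false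
  rw [eval₁_eq_of_dayOuter (by omega) ((hS 0 (by omega)).1 (by simp))] at h1
  have h2 := eval₁_dayBasic_last (by omega) hB false false true true
  rw [← eval₁_eq_of_dayOuter (by omega) ((hS (2 * n) (by omega)).1 (by simp))] at h2
  have h1' := eval₁_dayBasic_absorbs (by omega) hB (show 0 + 1 ≤ 2 * n + 1 by omega) true false
  have h2' := eval₁_dayBasic_absorbs (by omega) hB (show 2 * n ≤ 2 * n + 1 by omega) true false
  have s1 := star_eq_of_two hn (j := 0) (by decide) h1 h1'
  have s2 := star_eq_of_two hn (j := 3) (by decide) h2 h2'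
  have hB' := Interpretable.dayBasic exists_gens_ev4 hB
  refine ⟨fun k => star (u (k + 1)), ⟨fun A hA x y z w => ⟨s1 A hA _, ?_⟩,
    fun k hk => hB'.2 (k + 1) (by omega)⟩, fun k hk => ⟨fun he => ?_, fun ho => ?_⟩⟩
  · dsimp only
    rw [show 2 * n - 1 + 1 = 2 * n by omega]
    exact s2 A hA _
  · exact Interpretable.dayInner exists_gens_ev4 ((hS (k + 1) (by omega)).2 (by grind))
  · exact Interpretable.dayOuter exists_gens_ev4 ((hS (k + 1) (by omega)).1 (by grind))

theorem not_isModular_one {L : FirstOrder.Language.{0, 0}} {V : AlgClass L}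
    {A : Bundled.{0} L.Structure} (hA : A ∈ V) {x y : A} (hxy : x ≠ y) : ¬ IsModular V 1 := by
  rintro ⟨u, hB, hS⟩
  have := (hS 0 (by omega)).1 (by simp) A hA x y
  rw [(hB.1 A hA _ _ _ _).1, (hB.1 A hA _ _ _ _).2] at this
  exact hxy this

/-- The two claims feed each other, as deletion exchanges Day and reversed Day terms. A Boolean
generator must be followed by a lattice for the step from the second claim to the first; for odd n
the descent ends at n = 3, whose only generator must be a lattice. -/
theorem not_isModular_gens (hn : 2 ≤ n) : ∀ b : ℕ → Bool,
    (∀ i, b i = true → b (i + 1) = false) → (Odd n → b (n / 2) = false) →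
    (b 1 = false → ¬ IsReversedModular (gens n b) (2 * n - 1)) ∧
      (b 1 = true → ¬ IsModular (gens n b) (2 * n - 3)) := by
  induction n using Nat.strong_induction_on with
  | _ n ih =>
    intro b hb hodd
    obtain rfl | rfl | ⟨k, hk, rfl⟩ : n = 2 ∨ n = 3 ∨ ∃ k, 2 ≤ k ∧ n = k + 2 := by
      rcases Nat.lt_or_ge n 4 with h | h
      · omega
      · exact .inr (.inr ⟨n - 2, by omega, by omega⟩)
    · exact ⟨not_isReversedModular_gens_two, fun _ =>
        not_isModular_one (gen_mem_gens (i := 1) le_rfl le_rfl) Bool.false_ne_true⟩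
    · refine ⟨not_isReversedModular_gens_three, fun h => ?_⟩
      rw [hodd (by decide)] at h
      cases h
    · obtain ⟨ih1, ih2⟩ := ih k (by omega) hk (fun i => b (i + 1)) (fun i => hb (i + 1)) (by
        intro ho
        rw [← hodd (by grind)]
        congr 1
        omega)
      refine ⟨fun h1 h => ?_, fun h1 h => ?_⟩
      · have h' := IsReversedModular.reduce hk h1 h
        -- After a lattice either kind may follow. For a second lattice, Day terms become reversed
        -- Day terms at the cost of one more link, which still fits below 2k - 1.
        cases h2 : b 2
        · exact ih1 h2 (h'.isReversedModular.mono (by omega))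
        · exact ih2 h2 h'
      · exact ih1 (hb 1 h1) (IsModular.reduce hk h)

/-! ### Lower bounds for the switch levels -/

theorem HasSwitchTerms.hasJSwitchTerms {L : FirstOrder.Language.{0, 0}} {K : AlgClass L} {l : ℕ}
    (h : HasSwitchTerms K l) : HasJSwitchTerms K l := by
  obtain ⟨s, r, hE, hC⟩ := h
  exact ⟨s, r, fun A hA x z => (hE A hA _ _ _).1.symm, fun A hA x z => (hE A hA _ _ _).2, hC⟩

theorem SwitchChain.star {l m k : ℕ} {s r : ℕ → (sig (n + 2)).Term (Fin 3)}
    (h : SwitchChain (gens (n + 2) b) l s r) (hm : m + k ≤ l) :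
    SwitchChain (gens n fun i => b (i + 1)) m (fun h => CongLevels.star (s (h + k)))
      fun h => CongLevels.star (r (h + k)) := by
  refine ⟨fun h' hh => star_absorbs (h.1 _ (by omega)), fun h' hh => ?_⟩
  obtain ⟨h1, h2⟩ := h.2 (h' + k) (by omega)
  rw [show h' + k + 1 = h' + 1 + k by omega] at h2
  exact ⟨star_eqRight h1, star_eqLeft h2⟩

/-- Monotonicity of r_0 bridges (1,0,0) and (1,1,0), and carries the value from s_0 to s_1. -/
theorem eval₁_switchTerms (hn : 2 ≤ n) (hb : b 1 = false) {l : ℕ}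
    {s r : ℕ → (sig n).Term (Fin 3)} (hE : Ends (gens n b) (l + 1) s)
    (hC : SwitchChain (gens n b) (l + 1) s r) :
    eval₁ b (s 1) ![true, true, false] = true ∧ eval₁ b (s l) ![false, true, true] = true := by
  have h0 := (eval₁_ends hn hE true false false).1
  rw [eval₁_eq_of_eqRight hn (hC.2 0 (by omega)).1] at h0
  have h1 := eval₁_mono hb h0 (w := ![true, true, false]) (by decide)
  rw [eval₁_eq_of_eqLeft hn (hC.2 0 (by omega)).2] at h1
  have g0 := (eval₁_ends hn hE false false true).2
  rw [← eval₁_eq_of_eqLeft hn (hC.2 l (by omega)).2] at g0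
  have g1 := eval₁_mono hb g0 (w := ![false, true, true]) (by decide)
  rw [← eval₁_eq_of_eqRight hn (hC.2 l (by omega)).1] at g1
  exact ⟨h1, g1⟩

theorem not_hasSwitchTerms_gens_two (hb : b 1 = false) : ¬ HasSwitchTerms (gens 2 b) 1 := by
  rintro ⟨s, r, hE, hC⟩
  have h := (eval₁_switchTerms (l := 0) le_rfl hb hE hC).1
  rw [(eval₁_ends le_rfl hE _ _ _).2] at h
  cases h

theorem not_hasSwitchTerms_gens_three (hb : b 1 = false) : ¬ HasSwitchTerms (gens 3 b) 2 := by
  rintro ⟨s, r, hE, hC⟩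
  obtain ⟨h1, h2⟩ := eval₁_switchTerms (l := 1) (by omega) hb hE hC
  have h3 := eval₁_of_absorbs (by omega) (hC.1 1 (by omega)) true false
  obtain ⟨j, hj⟩ := exists_le_var (c := b 1) le_rfl (s 1)
  have : ∀ j : Fin 3, ![true, true, false] j = true → ![false, true, true] j = true →
      ![true, false, true] j = true → False := by decide
  exact this j (hj _ h1) (hj _ h2) (hj _ h3)

/-- Over a lattice, s_1 and s_{l+1} already become x and z, so the two outer factors α(γ ∘ β)
disappear. -/
theorem HasSwitchTerms.reduce (hn : 2 ≤ n) (hb : b 1 = false) {l : ℕ}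
    (h : HasSwitchTerms (gens (n + 2) b) (l + 2)) :
    HasSwitchTerms (gens n fun i => b (i + 1)) l := by
  obtain ⟨s, r, hE, hC⟩ := h
  obtain ⟨h1, h2⟩ := eval₁_switchTerms (l := l + 1) (by omega) hb hE hC
  have h1' := eval₁_of_absorbs (by omega) (hC.1 1 (by omega)) true false
  have h2' := eval₁_of_absorbs (by omega) (hC.1 (l + 1) (by omega)) true false
  have s1 := star_eq_of_two hn (j := 0) (by decide) h1 h1'
  have s2 := star_eq_of_two hn (j := 2) (by decide) h2 h2'
  exact ⟨fun h => star (s (h + 1)), fun h => star (r (h + 1)),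
    fun A hA x y z => ⟨s1 A hA _, s2 A hA _⟩, hC.star (k := 1) (by omega)⟩

/-- The identities at the ends are used directly, without monotonicity, so the first generator may
be Boolean: only the factors αβ and αγ collapse. -/
theorem HasJSwitchTerms.reduce (hn : 2 ≤ n) {l : ℕ} (h : HasJSwitchTerms (gens (n + 2) b) l) :
    HasSwitchTerms (gens n fun i => b (i + 1)) l := by
  obtain ⟨s, r, hL, hR, hC⟩ := h
  have h1 : eval₁ b (s 0) ![true, true, false] = true :=
    (eval₁_eq_of_eqLeft (by omega) hL true false).symm
  have h2 : eval₁ b (s l) ![false, true, true] = true :=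
    eval₁_eq_of_eqRight (by omega) hR false true
  have h1' := eval₁_of_absorbs (by omega) (hC.1 0 (by omega)) true false
  have h2' := eval₁_of_absorbs (by omega) (hC.1 l (by omega)) true false
  have s1 := star_eq_of_two hn (j := 0) (by decide) h1 h1'
  have s2 := star_eq_of_two hn (j := 2) (by decide) h2 h2'
  exact ⟨fun h => star (s h), fun h => star (r h), fun A hA x y z => ⟨s1 A hA _, s2 A hA _⟩,
    hC.star (k := 0) (by omega)⟩

theorem not_hasSwitchTerms_gens_lattice (hn : 2 ≤ n) (hb : ∀ i, 1 ≤ i → b i = false) :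
    ¬ HasSwitchTerms (gens n b) (n - 1) := by
  induction n using Nat.strong_induction_on generalizing b with
  | _ n ih =>
    obtain rfl | rfl | ⟨k, hk, rfl⟩ : n = 2 ∨ n = 3 ∨ ∃ k, 2 ≤ k ∧ n = k + 2 := by
      rcases Nat.lt_or_ge n 4 with h | h
      · omega
      · exact .inr (.inr ⟨n - 2, by omega, by omega⟩)
    · exact not_hasSwitchTerms_gens_two (hb 1 le_rfl)
    · exact not_hasSwitchTerms_gens_three (hb 1 le_rfl)
    · intro h
      rw [show k + 2 - 1 = k - 1 + 2 by omega] at h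
      exact ih k (by omega) hk (fun i _ => hb (i + 1) (by omega)) (h.reduce hk (hb 1 le_rfl))

theorem not_hasSwitchTerms_zero (hn : 2 ≤ n) : ¬ HasSwitchTerms (gens n b) 0 := by
  rintro ⟨s, r, hE, -⟩
  have := (eval₁_ends hn hE true true false).1
  rw [(eval₁_ends hn hE true true false).2] at this
  cases this

/-- Deleting a lattice costs two factors and deleting a Boolean generator costs none, while the two
alternating patterns are exchanged. -/
theorem not_hasSwitchTerms_gens_alternating (k : ℕ) :
    ¬ HasSwitchTerms (gens (2 * k + 2) fun i => decide (Even i)) (k + 1) ∧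
      ¬ HasSwitchTerms (gens (2 * k + 2) fun i => decide (Odd i)) k := by
  induction k with
  | zero => exact ⟨not_hasSwitchTerms_gens_two (by decide), not_hasSwitchTerms_zero le_rfl⟩
  | succ k ih =>
    refine ⟨fun h => ih.2 ?_, fun h => ih.1 ?_⟩
    · have := h.reduce (n := 2 * k + 2) (by omega) (by decide)
      simpa [parity_simps] using this
    · have := h.hasJSwitchTerms.reduce (n := 2 * k + 2) (by omega)
      simpa [parity_simps] using this

theorem not_hasJSwitchTerms_gens_alternating (k : ℕ) :
    ¬ HasJSwitchTerms (gens (2 * k + 4) fun i => decide (Odd i)) (k + 1) := by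
  intro h
  have := h.reduce (n := 2 * k + 2) (by omega)
  exact (not_hasSwitchTerms_gens_alternating k).1 (by simpa [parity_simps] using this)

/-- With α and β full and γ equality, the right-hand side is equality. This covers Vb for n = 2,
which the J-switch argument does not reach. -/
theorem not_isSwitch_one {L : FirstOrder.Language.{0, 0}} {V : AlgClass L}
    {A : Bundled.{0} L.Structure} (hA : A ∈ V) {x y : A} (hxy : x ≠ y) : ¬ IsSwitch V 1 := by
  intro h
  let top : Congruence A := ⟨⊤, fun _ _ _ _ => trivial⟩
  let bot : Congruence A := ⟨⊥, fun f v w h => by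
    rw [show v = w from funext h]⟩
  obtain ⟨c, h1, h2⟩ := (h A hA top top bot).2 odd_one
    (show (x, y) ∈ _ from ⟨trivial, y, trivial, bot.refl' y⟩)
  have e1 : x = c := h1
  have e2 : c = y := h2.2
  exact hxy (e1.trans e2)

end Reduction

/-! ### The varieties of the theorem -/

section Varieties

variable {n : ℕ}

theorem isDirectedDistributive_Va (hn : 2 ≤ n) : IsDirectedDistributive (Va n) n := by
  rw [Va_eq]
  exact (isDirectedDistributive_gens hn).variety

theorem isDirectedDistributive_Vb (hn : 2 ≤ n) : IsDirectedDistributive (Vb n) n := by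
  rw [Vb_eq]
  exact (isDirectedDistributive_gens hn).variety

theorem isDirectedDistributive_Vc (hn : 2 ≤ n) : IsDirectedDistributive (Vc n) n := by
  rw [Vc_eq]
  exact (isDirectedDistributive_gens hn).variety

theorem isDirectedDistributive_Vd (hn : 2 ≤ n) : IsDirectedDistributive (Vd n) n := by
  rw [Vd_eq hn]
  exact (isDirectedDistributive_gens hn).variety

theorem isDistributive_Va (hn : 2 ≤ n) (he : Even n) : IsDistributive (Va n) n := by
  rw [Va_eq]
  exact (isDistributive_gens hn he).variety

theorem isAlvin_Vb (hn : 2 ≤ n) (he : Even n) : IsAlvin (Vb n) n := by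
  rw [Vb_eq]
  exact (isAlvin_gens hn he).variety

theorem isDirectedAlvinHeads_Vb (hn : 4 ≤ n) : IsDirectedAlvinHeads (Vb n) n := by
  rw [Vb_eq]
  exact (isDirectedAlvinHeads_gens hn (by decide)).variety

theorem isDirectedAlvinHeads_Vd (hn : 4 ≤ n) : IsDirectedAlvinHeads (Vd n) n := by
  rw [Vd_eq (by omega)]
  exact (isDirectedAlvinHeads_gens hn (by decide)).variety

theorem isModular_Vb (hn : 2 ≤ n) (he : Even n) : IsModular (Vb n) (2 * n - 2) := by
  rcases Nat.lt_or_ge n 4 with h | h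
  · obtain rfl : n = 2 := by grind
    rw [Vb_eq]
    exact (isModular_gens_two (by decide)).variety
  · have := (isDirectedAlvinHeads_Vb h).isTwoHeadedDirectedGumm.isReversedModular.isModular
    rwa [show 2 * n - 3 + 1 = 2 * n - 2 by omega] at this

theorem not_isReversedModular_Va (hn : 2 ≤ n) (he : Even n) :
    ¬ IsReversedModular (Va n) (2 * n - 1) := by
  rw [Va_eq]
  exact fun h => (not_isModular_gens hn (fun i => decide (Even i))
    (fun i => by simp [parity_simps]) (by grind)).1 (by decide) h.of_variety

theorem not_isModular_Vb (hn : 2 ≤ n) (he : Even n) : ¬ IsModular (Vb n) (2 * n - 3) := by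
  rw [Vb_eq]
  exact fun h => (not_isModular_gens hn (fun i => decide (Odd i))
    (fun i => by simp [parity_simps]) (by grind)).2 (by decide) h.of_variety

theorem not_isReversedModular_Vc (hn : 2 ≤ n) : ¬ IsReversedModular (Vc n) (2 * n - 1) := by
  rw [Vc_eq]
  exact fun h => (not_isModular_gens hn (fun _ => false) (by simp) (by simp)).1 rfl h.of_variety

theorem not_isModular_Vd (hn : 4 ≤ n) : ¬ IsModular (Vd n) (2 * n - 3) := by
  rw [Vd_eq (by omega)]
  exact fun h => (not_isModular_gens (by omega) (fun i => decide (i = 1))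
    (fun i => by simp; omega) (fun _ => by simp; omega)).2 rfl h.of_variety

theorem not_isSwitch_Va (hn : 2 ≤ n) (he : Even n) : ¬ IsSwitch (Va n) n := by
  rw [Va_eq]
  intro h
  obtain ⟨k, rfl⟩ : ∃ k, n = 2 * (k + 1) := ⟨n / 2 - 1, by grind⟩
  exact (not_hasSwitchTerms_gens_alternating k).1 (IsSwitch.hasSwitchTerms h)

theorem not_isSwitch_Vc (hn : 2 ≤ n) : ¬ IsSwitch (Vc n) (2 * n - 2) := by
  rw [Vc_eq, show 2 * n - 2 = 2 * (n - 1) by omega]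
  exact fun h => not_hasSwitchTerms_gens_lattice hn (fun _ _ => rfl) (IsSwitch.hasSwitchTerms h)

theorem not_isJSwitch_Vb (hn : 4 ≤ n) (he : Even n) : ¬ IsJSwitch (Vb n) n := by
  rw [Vb_eq]
  intro h
  obtain ⟨k, rfl⟩ : ∃ k, n = 2 * (k + 1) + 2 := ⟨n / 2 - 2, by grind⟩
  exact not_hasJSwitchTerms_gens_alternating k (IsJSwitch.hasJSwitchTerms h)

/-- Once the Boolean first generator is deleted, only lattices remain, and the switch bound for
lattices at n - 2 applies. -/
theorem not_isJSwitch_Vd (hn : 4 ≤ n) : ¬ IsJSwitch (Vd n) (2 * n - 4) := by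
  rw [Vd_eq (by omega)]
  intro h
  obtain ⟨k, rfl⟩ : ∃ k, n = k + 2 := ⟨n - 2, by omega⟩
  rw [show 2 * (k + 2) - 4 = 2 * (k - 1) + 2 by omega] at h
  exact not_hasSwitchTerms_gens_lattice (n := k) (by omega) (fun i hi => by simp; omega)
    ((IsJSwitch.hasJSwitchTerms h).reduce (n := k) (by omega))

theorem not_isSwitch_Vb (hn : 2 ≤ n) (he : Even n) : ¬ IsSwitch (Vb n) (n - 1) := by
  rcases Nat.lt_or_ge n 4 with h | h
  · obtain rfl : n = 2 := by grind
    rw [Vb_eq]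
    exact not_isSwitch_one (subset_variety (gen_mem_gens (i := 1) le_rfl le_rfl))
      Bool.false_ne_true
  · refine not_isSwitch_of_not_isJSwitch ?_
    rw [show n - 1 + 1 = n by omega]
    exact not_isJSwitch_Vb h he

theorem interpretable_Ve_Va : Interpretable (Ve n) (Va n) :=
  interpretable_fst (V := Va n) (W := Vb n) unitAlg_mem_variety ()

theorem interpretable_Ve_Vb : Interpretable (Ve n) (Vb n) :=
  interpretable_snd (V := Va n) (W := Vb n) unitAlg_mem_variety ()

theorem interpretable_Vf_Vc : Interpretable (Vf n) (Vc n) :=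
  interpretable_fst (V := Vc n) (W := Vd (n + 1)) unitAlg_mem_variety ()

theorem interpretable_Vf_Vd : Interpretable (Vf n) (Vd (n + 1)) :=
  interpretable_snd (V := Vc n) (W := Vd (n + 1)) unitAlg_mem_variety ()

end Varieties

/-! ### The columns of the table -/

section Columns

variable {n : ℕ}

theorem levels_Va (hn : 2 ≤ n) (he : Even n) :
    HasLevel IsDistributive (Va n) n ∧ HasLevel IsJSwitch (Va n) n ∧
    HasLevel IsAlvin (Va n) (n + 1) ∧ HasLevel IsGumm (Va n) (n + 1) ∧
    HasLevel IsSwitch (Va n) (n + 1) ∧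
    HasLevel IsModular (Va n) (2 * n - 1) ∧
    HasLevel IsReversedModular (Va n) (2 * n) ∧
    HasLevel IsDirectedDistributive (Va n) n ∧ HasLevel IsMixed (Va n) n ∧
    HasLevel IsTwoHeadedDirectedGumm (Va n) (n + 2) ∧
    HasLevel IsDirectedAlvinHeads (Va n) (n + 2) := by
  have hdir := isDirectedDistributive_Va hn
  have hdist := isDistributive_Va hn he
  have hmod := hdir.isMixed.isModular
  have hrev := hmod.isReversedModular
  rw [show 2 * n - 1 + 1 = 2 * n by omega] at hrev
  have hheads := hdir.isDirectedAlvinHeads hn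
  obtain ⟨l1, l2, l3, l4, l5, l6⟩ :=
    le_of_not_isReversedModular (not_isReversedModular_Va hn he) (by omega)
  have hs := not_isSwitch_Va hn he
  obtain ⟨l7, l8, l9⟩ := le_of_not_isSwitch hs
  rw [show n = n - 1 + 1 by omega] at hs
  have hj := not_isJSwitch_of_not_isSwitch hs
  obtain ⟨l10, l11⟩ := le_of_not_isJSwitch hj (by omega)
  rw [show n - 1 + 1 = n by omega] at l10 l11
  exact ⟨⟨hdist, l10⟩, ⟨hdist.isJSwitch (by omega), l11⟩, ⟨hdist.isAlvin, l8⟩,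
    ⟨hdist.isAlvin.isGumm, l9⟩, ⟨hdist.isAlvin.isGumm.isSwitch, l7⟩, ⟨hmod, l1⟩, ⟨hrev, l2⟩,
    ⟨hdir, l3⟩, ⟨hdir.isMixed, l4⟩, ⟨hheads.isTwoHeadedDirectedGumm, l5⟩, ⟨hheads, l6⟩⟩

theorem levels_Vb (hn : 2 ≤ n) (he : Even n) :
    (4 ≤ n → HasLevel IsDistributive (Vb n) (n + 1) ∧ HasLevel IsJSwitch (Vb n) (n + 1)) ∧
    HasLevel IsAlvin (Vb n) n ∧ HasLevel IsGumm (Vb n) n ∧ HasLevel IsSwitch (Vb n) n ∧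
    HasLevel IsModular (Vb n) (2 * n - 2) ∧
    (4 ≤ n → HasLevel IsReversedModular (Vb n) (2 * n - 3)) ∧
    HasLevel IsDirectedDistributive (Vb n) n ∧ HasLevel IsMixed (Vb n) n ∧
    (4 ≤ n → HasLevel IsTwoHeadedDirectedGumm (Vb n) n ∧
      HasLevel IsDirectedAlvinHeads (Vb n) n) := by
  have hdir := isDirectedDistributive_Vb hn
  have halv := isAlvin_Vb hn he
  obtain ⟨l1, l2, l3, l4, l5, l6⟩ := le_of_not_isModular (not_isModular_Vb hn he) hn
  obtain ⟨l7, l8, l9⟩ := le_of_not_isSwitch (not_isSwitch_Vb hn he)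
  rw [show n - 1 + 1 = n by omega] at l7 l8 l9
  refine ⟨fun h4 => ?_, ⟨halv, l8⟩, ⟨halv.isGumm, l9⟩, ⟨halv.isGumm.isSwitch, l7⟩,
    ⟨isModular_Vb hn he, l1⟩, fun h4 => ?_, ⟨hdir, l3⟩, ⟨hdir.isMixed, l4⟩, fun h4 => ?_⟩
  · obtain ⟨l10, l11⟩ := le_of_not_isJSwitch (not_isJSwitch_Vb h4 he) (by omega)
    exact ⟨⟨halv.isDistributive, l10⟩, ⟨halv.isDistributive.isJSwitch (by omega), l11⟩⟩
  · exact ⟨(isDirectedAlvinHeads_Vb h4).isTwoHeadedDirectedGumm.isReversedModular, l2⟩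
  · exact ⟨⟨(isDirectedAlvinHeads_Vb h4).isTwoHeadedDirectedGumm, l5⟩,
      ⟨isDirectedAlvinHeads_Vb h4, l6⟩⟩

theorem levels_Vc (hn : 2 ≤ n) :
    HasLevel IsDistributive (Vc n) (2 * n - 2) ∧ HasLevel IsJSwitch (Vc n) (2 * n - 2) ∧
    HasLevel IsAlvin (Vc n) (2 * n - 1) ∧ HasLevel IsGumm (Vc n) (2 * n - 1) ∧
    HasLevel IsSwitch (Vc n) (2 * n - 1) ∧
    HasLevel IsModular (Vc n) (2 * n - 1) ∧
    HasLevel IsReversedModular (Vc n) (2 * n) ∧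
    HasLevel IsDirectedDistributive (Vc n) n ∧ HasLevel IsMixed (Vc n) n ∧
    HasLevel IsTwoHeadedDirectedGumm (Vc n) (n + 2) ∧
    HasLevel IsDirectedAlvinHeads (Vc n) (n + 2) := by
  have hdir := isDirectedDistributive_Vc hn
  have hdist := hdir.isDistributive (by omega)
  have halv := hdist.isAlvin
  rw [show 2 * n - 2 + 1 = 2 * n - 1 by omega] at halv
  have hmod := hdir.isMixed.isModular
  have hrev := hmod.isReversedModular
  rw [show 2 * n - 1 + 1 = 2 * n by omega] at hrev
  have hheads := hdir.isDirectedAlvinHeads hn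
  obtain ⟨l1, l2, l3, l4, l5, l6⟩ :=
    le_of_not_isReversedModular (not_isReversedModular_Vc hn) (by omega)
  have hs := not_isSwitch_Vc hn
  obtain ⟨l7, l8, l9⟩ := le_of_not_isSwitch hs
  rw [show 2 * n - 2 + 1 = 2 * n - 1 by omega] at l7 l8 l9
  rw [show 2 * n - 2 = 2 * n - 3 + 1 by omega] at hs
  obtain ⟨l10, l11⟩ := le_of_not_isJSwitch (not_isJSwitch_of_not_isSwitch hs) (by omega)
  rw [show 2 * n - 3 + 1 = 2 * n - 2 by omega] at l10 l11
  exact ⟨⟨hdist, l10⟩, ⟨hdist.isJSwitch (by omega), l11⟩, ⟨halv, l8⟩, ⟨halv.isGumm, l9⟩,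
    ⟨halv.isGumm.isSwitch, l7⟩, ⟨hmod, l1⟩, ⟨hrev, l2⟩, ⟨hdir, l3⟩, ⟨hdir.isMixed, l4⟩,
    ⟨hheads.isTwoHeadedDirectedGumm, l5⟩, ⟨hheads, l6⟩⟩

theorem levels_Vd (hn : 4 ≤ n) :
    HasLevel IsDistributive (Vd n) (2 * n - 3) ∧ HasLevel IsJSwitch (Vd n) (2 * n - 3) ∧
    HasLevel IsAlvin (Vd n) (2 * n - 4) ∧ HasLevel IsGumm (Vd n) (2 * n - 4) ∧
    HasLevel IsSwitch (Vd n) (2 * n - 4) ∧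
    HasLevel IsModular (Vd n) (2 * n - 2) ∧
    HasLevel IsReversedModular (Vd n) (2 * n - 3) ∧
    HasLevel IsDirectedDistributive (Vd n) n ∧ HasLevel IsMixed (Vd n) n ∧
    HasLevel IsTwoHeadedDirectedGumm (Vd n) n ∧
    HasLevel IsDirectedAlvinHeads (Vd n) n := by
  have hdir := isDirectedDistributive_Vd (n := n) (by omega)
  have hheads := isDirectedAlvinHeads_Vd hn
  have halv := hheads.isAlvin
  have hdist := halv.isDistributive
  rw [show 2 * n - 4 + 1 = 2 * n - 3 by omega] at hdist
  have hrev := hheads.isTwoHeadedDirectedGumm.isReversedModular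
  have hmod := hrev.isModular
  rw [show 2 * n - 3 + 1 = 2 * n - 2 by omega] at hmod
  obtain ⟨l1, l2, l3, l4, l5, l6⟩ := le_of_not_isModular (not_isModular_Vd hn) (by omega)
  have hj := not_isJSwitch_Vd hn
  obtain ⟨l10, l11⟩ := le_of_not_isJSwitch hj (by omega)
  rw [show 2 * n - 4 + 1 = 2 * n - 3 by omega] at l10 l11
  rw [show 2 * n - 4 = 2 * n - 5 + 1 by omega] at hj
  obtain ⟨l7, l8, l9⟩ := le_of_not_isSwitch (not_isSwitch_of_not_isJSwitch hj)
  rw [show 2 * n - 5 + 1 = 2 * n - 4 by omega] at l7 l8 l9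
  exact ⟨⟨hdist, l10⟩, ⟨hdist.isJSwitch (by omega), l11⟩, ⟨halv, l8⟩, ⟨halv.isGumm, l9⟩,
    ⟨halv.isGumm.isSwitch, l7⟩, ⟨hmod, l1⟩, ⟨hrev, l2⟩, ⟨hdir, l3⟩, ⟨hdir.isMixed, l4⟩,
    ⟨hheads.isTwoHeadedDirectedGumm, l5⟩, ⟨hheads, l6⟩⟩

/-- All lower bounds are inherited from `Va n`, except those for the distributive and J-switch
levels, which come from `Vb n`. -/
theorem levels_Ve (hn : 2 ≤ n) (he : Even n) :
    (4 ≤ n → HasLevel IsDistributive (Ve n) (n + 1) ∧ HasLevel IsJSwitch (Ve n) (n + 1)) ∧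
    HasLevel IsAlvin (Ve n) (n + 1) ∧ HasLevel IsGumm (Ve n) (n + 1) ∧
    HasLevel IsSwitch (Ve n) (n + 1) ∧
    HasLevel IsModular (Ve n) (2 * n - 1) ∧
    HasLevel IsReversedModular (Ve n) (2 * n) ∧
    HasLevel IsDirectedDistributive (Ve n) n ∧ HasLevel IsMixed (Ve n) n ∧
    HasLevel IsTwoHeadedDirectedGumm (Ve n) (n + 2) ∧
    HasLevel IsDirectedAlvinHeads (Ve n) (n + 2) := by
  have hdir : IsDirectedDistributive (Ve n) n :=
    (isDirectedDistributive_Va hn).prod (isDirectedDistributive_Vb hn)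
  have hdist : IsDistributive (Ve n) (n + 1) :=
    ((isDistributive_Va hn he).mono (by omega)).prod (isAlvin_Vb hn he).isDistributive
  have halv : IsAlvin (Ve n) (n + 1) :=
    (isDistributive_Va hn he).isAlvin.prod ((isAlvin_Vb hn he).mono (by omega))
  have hmod := hdir.isMixed.isModular
  have hrev := hmod.isReversedModular
  rw [show 2 * n - 1 + 1 = 2 * n by omega] at hrev
  have hheads := hdir.isDirectedAlvinHeads hn
  obtain ⟨l1, l2, l3, l4, l5, l6⟩ := le_of_not_isReversedModular (V := Ve n)
    (fun h => not_isReversedModular_Va hn he (interpretable_Ve_Va.isReversedModular h)) (by omega)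
  obtain ⟨l7, l8, l9⟩ := le_of_not_isSwitch (V := Ve n)
    fun h => not_isSwitch_Va hn he (interpretable_Ve_Va.isSwitch h)
  refine ⟨fun h4 => ?_, ⟨halv, l8⟩, ⟨halv.isGumm, l9⟩, ⟨halv.isGumm.isSwitch, l7⟩, ⟨hmod, l1⟩,
    ⟨hrev, l2⟩, ⟨hdir, l3⟩, ⟨hdir.isMixed, l4⟩, ⟨hheads.isTwoHeadedDirectedGumm, l5⟩,
    ⟨hheads, l6⟩⟩
  obtain ⟨l10, l11⟩ := le_of_not_isJSwitch (V := Ve n)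
    (fun h => not_isJSwitch_Vb h4 he (interpretable_Ve_Vb.isJSwitch h)) (by omega)
  exact ⟨⟨hdist, l10⟩, ⟨hdist.isJSwitch (by omega), l11⟩⟩

/-- The factor `Vc n` forces the reversed-modular, alvin, Gumm, switch and two-headed bounds; `Vd (n
+ 1)` forces the modular, distributive, J-switch, directed and mixed ones. -/
theorem levels_Vf (hn : 3 ≤ n) :
    HasLevel IsDistributive (Vf n) (2 * n - 1) ∧ HasLevel IsJSwitch (Vf n) (2 * n - 1) ∧
    HasLevel IsAlvin (Vf n) (2 * n - 1) ∧ HasLevel IsGumm (Vf n) (2 * n - 1) ∧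
    HasLevel IsSwitch (Vf n) (2 * n - 1) ∧
    HasLevel IsModular (Vf n) (2 * n) ∧
    HasLevel IsReversedModular (Vf n) (2 * n) ∧
    HasLevel IsDirectedDistributive (Vf n) (n + 1) ∧ HasLevel IsMixed (Vf n) (n + 1) ∧
    HasLevel IsTwoHeadedDirectedGumm (Vf n) (n + 2) ∧
    HasLevel IsDirectedAlvinHeads (Vf n) (n + 2) := by
  obtain ⟨c1, -, c2, -, -, c3, c4, c5, -, -, c6⟩ := levels_Vc (n := n) (by omega)
  obtain ⟨d1, -, d2, -, -, d3, d4, d5, -, -, d6⟩ := levels_Vd (n := n + 1) (by omega)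
  have hdist : IsDistributive (Vf n) (2 * n - 1) :=
    (IsDistributive.mono c1.1 (by omega)).prod (IsDistributive.mono d1.1 (by omega))
  have halv : IsAlvin (Vf n) (2 * n - 1) :=
    IsAlvin.prod c2.1 (IsAlvin.mono d2.1 (by omega))
  have hmod : IsModular (Vf n) (2 * n) :=
    (IsModular.mono c3.1 (by omega)).prod (IsModular.mono d3.1 (by omega))
  have hrev : IsReversedModular (Vf n) (2 * n) :=
    IsReversedModular.prod c4.1 (IsReversedModular.mono d4.1 (by omega))
  have hdir : IsDirectedDistributive (Vf n) (n + 1) :=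
    (IsDirectedDistributive.mono c5.1 (by omega)).prod d5.1
  have hheads : IsDirectedAlvinHeads (Vf n) (n + 2) :=
    IsDirectedAlvinHeads.prod c6.1 (IsDirectedAlvinHeads.succ d6.1)
  obtain ⟨-, l2, -, -, l5, l6⟩ := le_of_not_isReversedModular (V := Vf n) (n := n)
    (fun h => not_isReversedModular_Vc (by omega) (interpretable_Vf_Vc.isReversedModular h))
    (by omega)
  obtain ⟨l1, -, l3, l4, -, -⟩ := le_of_not_isModular (V := Vf n) (n := n + 1)
    (fun h => not_isModular_Vd (by omega) (interpretable_Vf_Vd.isModular h)) (by omega)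
  obtain ⟨l7, l8, l9⟩ := le_of_not_isSwitch (V := Vf n)
    fun h => not_isSwitch_Vc (by omega) (interpretable_Vf_Vc.isSwitch h)
  obtain ⟨l10, l11⟩ := le_of_not_isJSwitch (V := Vf n)
    (fun h => not_isJSwitch_Vd (n := n + 1) (by omega) (interpretable_Vf_Vd.isJSwitch h))
    (by omega)
  rw [show 2 * (n + 1) - 2 = 2 * n by omega] at l1
  rw [show 2 * n - 2 + 1 = 2 * n - 1 by omega] at l7 l8 l9
  rw [show 2 * (n + 1) - 4 + 1 = 2 * n - 1 by omega] at l10 l11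
  exact ⟨⟨hdist, l10⟩, ⟨hdist.isJSwitch (by omega), l11⟩, ⟨halv, l8⟩, ⟨halv.isGumm, l9⟩,
    ⟨halv.isGumm.isSwitch, l7⟩, ⟨hmod, l1⟩, ⟨hrev, l2⟩, ⟨hdir, l3⟩, ⟨hdir.isMixed, l4⟩,
    ⟨hheads.isTwoHeadedDirectedGumm, l5⟩, ⟨hheads, l6⟩⟩

end Columns

end CongLevels

open CongLevels in
theorem mainTheorem7 :
    -- first column
    (∀ n : ℕ, 2 ≤ n → Even n →
      HasLevel IsDistributive (Va n) n ∧ HasLevel IsJSwitch (Va n) n ∧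
      HasLevel IsAlvin (Va n) (n + 1) ∧ HasLevel IsGumm (Va n) (n + 1) ∧
      HasLevel IsSwitch (Va n) (n + 1) ∧
      HasLevel IsModular (Va n) (2 * n - 1) ∧
      HasLevel IsReversedModular (Va n) (2 * n) ∧
      HasLevel IsDirectedDistributive (Va n) n ∧ HasLevel IsMixed (Va n) n ∧
      HasLevel IsTwoHeadedDirectedGumm (Va n) (n + 2) ∧
      HasLevel IsDirectedAlvinHeads (Va n) (n + 2)) ∧
    -- second column
    (∀ n : ℕ, 2 ≤ n → Even n →
      (4 ≤ n → HasLevel IsDistributive (Vb n) (n + 1) ∧ HasLevel IsJSwitch (Vb n) (n + 1)) ∧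
      HasLevel IsAlvin (Vb n) n ∧ HasLevel IsGumm (Vb n) n ∧ HasLevel IsSwitch (Vb n) n ∧
      HasLevel IsModular (Vb n) (2 * n - 2) ∧
      (4 ≤ n → HasLevel IsReversedModular (Vb n) (2 * n - 3)) ∧
      HasLevel IsDirectedDistributive (Vb n) n ∧ HasLevel IsMixed (Vb n) n ∧
      (4 ≤ n → HasLevel IsTwoHeadedDirectedGumm (Vb n) n ∧
        HasLevel IsDirectedAlvinHeads (Vb n) n)) ∧
    -- third column
    (∀ n : ℕ, 2 ≤ n →
      HasLevel IsDistributive (Vc n) (2 * n - 2) ∧ HasLevel IsJSwitch (Vc n) (2 * n - 2) ∧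
      HasLevel IsAlvin (Vc n) (2 * n - 1) ∧ HasLevel IsGumm (Vc n) (2 * n - 1) ∧
      HasLevel IsSwitch (Vc n) (2 * n - 1) ∧
      HasLevel IsModular (Vc n) (2 * n - 1) ∧
      HasLevel IsReversedModular (Vc n) (2 * n) ∧
      HasLevel IsDirectedDistributive (Vc n) n ∧ HasLevel IsMixed (Vc n) n ∧
      HasLevel IsTwoHeadedDirectedGumm (Vc n) (n + 2) ∧
      HasLevel IsDirectedAlvinHeads (Vc n) (n + 2)) ∧
    -- fourth column
    (∀ n : ℕ, 4 ≤ n →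
      HasLevel IsDistributive (Vd n) (2 * n - 3) ∧ HasLevel IsJSwitch (Vd n) (2 * n - 3) ∧
      HasLevel IsAlvin (Vd n) (2 * n - 4) ∧ HasLevel IsGumm (Vd n) (2 * n - 4) ∧
      HasLevel IsSwitch (Vd n) (2 * n - 4) ∧
      HasLevel IsModular (Vd n) (2 * n - 2) ∧
      HasLevel IsReversedModular (Vd n) (2 * n - 3) ∧
      HasLevel IsDirectedDistributive (Vd n) n ∧ HasLevel IsMixed (Vd n) n ∧
      HasLevel IsTwoHeadedDirectedGumm (Vd n) n ∧
      HasLevel IsDirectedAlvinHeads (Vd n) n) ∧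
    -- fifth column
    (∀ n : ℕ, 2 ≤ n → Even n →
      (4 ≤ n → HasLevel IsDistributive (Ve n) (n + 1) ∧ HasLevel IsJSwitch (Ve n) (n + 1)) ∧
      HasLevel IsAlvin (Ve n) (n + 1) ∧ HasLevel IsGumm (Ve n) (n + 1) ∧
      HasLevel IsSwitch (Ve n) (n + 1) ∧
      HasLevel IsModular (Ve n) (2 * n - 1) ∧
      HasLevel IsReversedModular (Ve n) (2 * n) ∧
      HasLevel IsDirectedDistributive (Ve n) n ∧ HasLevel IsMixed (Ve n) n ∧
      HasLevel IsTwoHeadedDirectedGumm (Ve n) (n + 2) ∧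
      HasLevel IsDirectedAlvinHeads (Ve n) (n + 2)) ∧
    -- sixth column
    (∀ n : ℕ, 3 ≤ n →
      HasLevel IsDistributive (Vf n) (2 * n - 1) ∧ HasLevel IsJSwitch (Vf n) (2 * n - 1) ∧
      HasLevel IsAlvin (Vf n) (2 * n - 1) ∧ HasLevel IsGumm (Vf n) (2 * n - 1) ∧
      HasLevel IsSwitch (Vf n) (2 * n - 1) ∧
      HasLevel IsModular (Vf n) (2 * n) ∧
      HasLevel IsReversedModular (Vf n) (2 * n) ∧
      HasLevel IsDirectedDistributive (Vf n) (n + 1) ∧ HasLevel IsMixed (Vf n) (n + 1) ∧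
      HasLevel IsTwoHeadedDirectedGumm (Vf n) (n + 2) ∧
      HasLevel IsDirectedAlvinHeads (Vf n) (n + 2)) := by exact
  ⟨fun _ => levels_Va, fun _ => levels_Vb, fun _ => levels_Vc, fun _ => levels_Vd,
    fun _ => levels_Ve, fun _ => levels_Vf⟩
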